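/- For $F\in\mathbb R^{2\times 2}$ let $\|F\|$ be the Frobenius norm, $$W_{\mathrm{Biot}}(F)=\bigl\|\sqrt{F^TF}-\mathbf 1_2\bigr\|^2,\qquad W_{\mathrm{dist}}(F)=\operatorname{dist}^2(F,\mathrm{SO}(2))=\min_{R\in \mathrm{SO}(2)}\|F-R\|^2,$$ and let $\mathrm{GL}^+(2)=\{F\in\mathbb R^{2\times2} : \det F>0\}$. A function $w:\mathbb R^{2\times 2}\to\mathbb R\cup\{+\infty\}$ is called quasiconvex if for every bounded open $\Omega\subset\mathbb R^2$ with $|\partial\Omega|=0$, every $F\in\mathbb R^{2\times 2}$ and every $\vartheta\in W^{1,\infty}_0(\Omega;\mathbb R^2)$ for which the following integral exists, $$\int_\Omega w(F+\nabla\vartheta(x))\,dx\ \ge\ |\Omega|\, w(F).$$ A function $Z:\mathrm{GL}^+(2)\to\mathbb R$ is called quasiconvex if its extension by $+\infty$ to $\mathbb R^{2\times 2}$ is quasiconvex. For $W:\mathbb R^{2\times 2}\to\mathbb R$ define the unconstrained envelope $$Q_{\mathbb R^{2\times 2}}W(F)=\sup\{w(F) : w:\mathbb R^{2\times 2}\to\mathbb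 R\cup\{+\infty\}\text{ quasiconvex},\ w\le W\},\qquad F\in\mathbb R^{2\times 2},$$ and the determinant-constrained envelope $$Q_{\mathrm{GL}^+(2)}W(F)=\sup\{Z(F) : Z:\mathrm{GL}^+(2)\to\mathbb R\text{ quasiconvex},\ Z\le W|_{\mathrm{GL}^+(2)}\},\qquad F\in\mathrm{GL}^+(2).$$ Then $W_{\mathrm{Biot}}=W_{\mathrm{dist}}$ on $\mathrm{GL}^+(2)$, and for every $F\in\mathrm{GL}^+(2)$ $$Q_{\mathrm{GL}^+(2)}W_{\mathrm{Biot}}(F)=Q_{\mathrm{GL}^+(2)}W_{\mathrm{dist}}(F)=Q_{\mathbb R^{2\times 2}}W_{\mathrm{dist}}(F)=\begin{cases}1-2\det F & \text{if } \|F\|^2+2\det F<1,\\ \bigl(\sqrt{\|F\|^2+2\det F}-1\bigr)^2+1-2\det F & \text{if } \|F\|^2+2\det F\ge 1.\end{cases}$$ Moreover, for the simple shear $F_\gamma=\begin{pmatrix}1&\gamma\\0&1\end{pmatrix}$, $\gamma\in\mathbb R$, $$Q_{\mathrm{GL}^+(2)}W_{\mathrm{Biot}}(F_\gamma)=W_{\mathrm{Biot}}(F_\gamma)=\bigl(\sqrt{4+\gamma^2}-1\bigr)^2-1,\qquad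 Q_{\mathbb R^{2\times 2}}W_{\mathrm{Biot}}(F_\gamma)=\Bigl(\frac{\sqrt{\gamma^2+4}+|\gamma|}{2}-1\Bigr)^2,$$ and hence $Q_{\mathbb R^{2\times 2}}W_{\mathrm{Biot}}(F_\gamma)<Q_{\mathrm{GL}^+(2)}W_{\mathrm{Biot}}(F_\gamma)$ for all $\gamma\ne0$; in particular the constrained and the unconstrained relaxations of $W_{\mathrm{Biot}}$ do not coincide on $\mathrm{GL}^+(2)$. -/

import Mathlib

open MeasureTheory Filter Topology
open scoped ContDiff MatrixOrder

noncomputable section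

namespace BiotRelaxation

/-- Real `n × n` matrices. -/
abbrev Mat (n : ℕ) : Type := Matrix (Fin n) (Fin n) ℝ

/-- Euclidean `n`-space. -/
abbrev Euc (n : ℕ) : Type := EuclideanSpace ℝ (Fin n)

/-- `GL⁺(n)`, the real `n × n` matrices with positive determinant. -/
abbrev GLPlus (n : ℕ) : Type := {F : Mat n // 0 < F.det}

/-! ### The two energies -/

/-- The squared Frobenius norm `‖A‖²`. -/
def frobSq {n : ℕ} (A : Mat n) : ℝ := ∑ i, ∑ j, A i j ^ 2

/-- The Biot-type energy `‖√(FᵀF) - 1‖²`; `CFC.sqrt` is the positive semidefinite square root. -/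
def wBiot {n : ℕ} (F : Mat n) : ℝ := frobSq (CFC.sqrt (F.transpose * F) - 1)

/-- The squared Euclidean distance `dist²(F, SO(n))`, where
`SO(n) = {R | RᵀR = 1, det R = 1}` is Mathlib's `Matrix.specialOrthogonalGroup`. -/
def wDist {n : ℕ} (F : Mat n) : ℝ :=
  ⨅ R : Matrix.specialOrthogonalGroup (Fin n) ℝ, frobSq (F - (R : Mat n))

/-- The restriction to `GL⁺(n)` of an energy on all matrices. -/
def restrictGL {n : ℕ} (W : Mat n → ℝ) : GLPlus n → ℝ := fun F => W F.1

/-! ### The Sobolev space `W₀^{1,∞}` -/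

/-- The `j`-th partial derivative of `φ` at `x`. -/
def partialDeriv {n : ℕ} (j : Fin n) (φ : Euc n → ℝ) (x : Euc n) : ℝ :=
  fderiv ℝ φ x (EuclideanSpace.single j 1)

/-- The space `C_c^∞(Ω)`. -/
def IsTestFunction {n : ℕ} (Ω : Set (Euc n)) (φ : Euc n → ℝ) : Prop :=
  ContDiff ℝ ∞ φ ∧ HasCompactSupport φ ∧ tsupport φ ⊆ Ω

/-- `u ∈ W₀^{1,∞}(Ω) = W^{1,∞}(Ω) ∩ W₀^{1,1}(Ω)` with weak gradient `g`. -/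
structure IsSobolevZero {n : ℕ} (Ω : Set (Euc n)) (u : Euc n → ℝ) (g : Euc n → Fin n → ℝ) :
    Prop where
  bounded : MemLp u ⊤ (volume.restrict Ω)
  bounded_grad : ∀ j, MemLp (fun x => g x j) ⊤ (volume.restrict Ω)
  weak_grad : ∀ φ, IsTestFunction Ω φ → ∀ j,
    ∫ x in Ω, u x * partialDeriv j φ x = - ∫ x in Ω, g x j * φ x
  /-- `u` is a limit in `W^{1,1}(Ω)` of functions in `C_c^∞(Ω)`. -/
  zero_boundary : ∃ φ : ℕ → Euc n → ℝ, (∀ k, IsTestFunction Ω (φ k)) ∧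
    Tendsto (fun k => ∫⁻ x in Ω, ‖φ k x - u x‖ₑ) atTop (𝓝 0) ∧
    ∀ j, Tendsto (fun k => ∫⁻ x in Ω, ‖partialDeriv j (φ k) x - g x j‖ₑ) atTop (𝓝 0)

/-- `θ ∈ W₀^{1,∞}(Ω; ℝⁿ)` with weak gradient `G`, where `G i j = ∂ⱼ θᵢ`. -/
def IsSobolevZeroVec {n : ℕ} (Ω : Set (Euc n)) (θ : Euc n → Euc n) (G : Euc n → Mat n) : Prop :=
  ∀ i, IsSobolevZero Ω (fun x => θ x i) (fun x j => G x i j)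

/-! ### Quasiconvexity -/

/-- Integral over `Ω` of the positive part of an extended real function. -/
def posInt {n : ℕ} (Ω : Set (Euc n)) (f : Euc n → EReal) : ENNReal :=
  ∫⁻ x in Ω, (f x).toENNReal

/-- Integral over `Ω` of the negative part of an extended real function. -/
def negInt {n : ℕ} (Ω : Set (Euc n)) (f : Euc n → EReal) : ENNReal :=
  ∫⁻ x in Ω, (-f x).toENNReal

/-- The Lebesgue integral `∫_Ω f` exists in `[-∞, +∞]`. -/
def IntegralExists {n : ℕ} (Ω : Set (Euc n)) (f : Euc n → EReal) : Prop :=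
  AEMeasurable f (volume.restrict Ω) ∧ (posInt Ω f ≠ ⊤ ∨ negInt Ω f ≠ ⊤)

/-- The value of `∫_Ω f` in `[-∞, +∞]`, meaningful when the integral exists. -/
def extIntegral {n : ℕ} (Ω : Set (Euc n)) (f : Euc n → EReal) : EReal :=
  (posInt Ω f : EReal) - (negInt Ω f : EReal)

/-- Quasiconvexity (that is, `W^{1,∞}`-quasiconvexity) of `w : ℝ^{n×n} → ℝ ∪ {+∞}`. -/
def Quasiconvex {n : ℕ} (w : Mat n → EReal) : Prop :=
  (∀ F, w F ≠ ⊥) ∧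
  ∀ Ω : Set (Euc n), IsOpen Ω → Bornology.IsBounded Ω → volume (frontier Ω) = 0 →
    ∀ (F : Mat n) (θ : Euc n → Euc n) (G : Euc n → Mat n), IsSobolevZeroVec Ω θ G →
      IntegralExists Ω (fun x => w (F + G x)) →
        (volume Ω : EReal) * w F ≤ extIntegral Ω (fun x => w (F + G x))

open Classical in
/-- The extension by `+∞` of a function on `GL⁺(n)` to all matrices. -/
def extendTop {n : ℕ} (Z : GLPlus n → ℝ) (F : Mat n) : EReal :=
  if h : 0 < F.det then (Z ⟨F, h⟩ : EReal) else ⊤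

/-- Quasiconvexity of a function on `GL⁺(n)`: that of its extension by `+∞`. -/
def QuasiconvexGL {n : ℕ} (Z : GLPlus n → ℝ) : Prop := Quasiconvex (extendTop Z)

/-- The unconstrained quasiconvex envelope `Q_{ℝ^{n×n}} W`. -/
def qcEnvelope {n : ℕ} (W : Mat n → ℝ) (F : Mat n) : EReal :=
  sSup {y | ∃ w : Mat n → EReal, Quasiconvex w ∧ (∀ X, w X ≤ (W X : EReal)) ∧ y = w F}

/-- The determinant-constrained quasiconvex envelope `Q_{GL⁺(n)} W`. -/
def qcEnvelopeGL {n : ℕ} (W : GLPlus n → ℝ) (F : GLPlus n) : EReal :=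
  sSup {y | ∃ Z : GLPlus n → ℝ, QuasiconvexGL Z ∧ (∀ X, Z X ≤ W X) ∧ y = (Z F : EReal)}

/-- The simple shear `F_γ = (1 γ; 0 1)`, an element of `GL⁺(2)`. -/
def shear (γ : ℝ) : GLPlus 2 := ⟨!![1, γ; 0, 1], by simp [Matrix.det_fin_two]⟩

end BiotRelaxation

end

namespace BiotRelaxation

/-! ### Test functions -/

/-! Each envelope is squeezed between a polyconvex minorant and a lamination upper bound.

Write `c = conf F` and `a = anticonf F`, so that `c² = ‖F‖² + 2 det F` and `a² = ‖F‖² - 2 det F`;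
the singular values are `(c + a)/2` and `|c - a|/2`. Then `wDist F = (c - 1)² + 1 - 2 det F`.
Replacing `(c - 1)²` by `((c - 1)₊)²` gives `relaxedDist`, a convex function plus an affine function
of the determinant. Entries and determinants of gradients are null Lagrangians, so such functions
are quasiconvex. Their restrictions to `GL⁺(2)` are too: a gradient field whose determinant has
nonpositive mean meets the value `+∞` on a set of positive measure.

Conversely, if `c < 1`, adding multiples of the first column to the second is a rank-one motion that
keeps the determinant and reaches `c = 1` in both directions; there `wDist` equals `1 - 2 det F`.
The determinant stays positive, so the same laminate serves both envelopes of `wDist`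
(`Quasiconvex.le_relaxedDist`).

`wBiot` sees only `|det F|` and equals `(σ₁ - 1)² + (σ₂ - 1)²` in singular values. Without the
constraint, the smaller singular value of a shear can be laminated between `1` and `-1`, crossing
`det = 0`, which leaves only `(σ₁ - 1)²` (`Quasiconvex.le_relaxedBiot_shear`). The convex function
`relaxedBiot` shows that this is optimal. The gap between the two envelopes is the lost term `(σ₂ -
1)²`. -/

lemma IsTestFunction.partialDeriv {n : ℕ} {Ω : Set (Euc n)} {φ : Euc n → ℝ}
    (h : IsTestFunction Ω φ) (j : Fin n) : IsTestFunction Ω (partialDeriv j φ) := by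
  obtain ⟨h1, h2, h3⟩ := h
  refine ⟨?_, h2.fderiv_apply ℝ _, (tsupport_fderiv_apply_subset ℝ _).trans h3⟩
  exact (h1.fderiv_right (m := ∞) le_rfl).clm_apply contDiff_const

lemma IsTestFunction.integrable {n : ℕ} {Ω : Set (Euc n)} {φ : Euc n → ℝ}
    (h : IsTestFunction Ω φ) : Integrable φ :=
  h.1.continuous.integrable_of_hasCompactSupport h.2.1

lemma IsTestFunction.eq_zero {n : ℕ} {Ω : Set (Euc n)} {φ : Euc n → ℝ}
    (h : IsTestFunction Ω φ) {x : Euc n} (hx : x ∉ Ω) : φ x = 0 :=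
  image_eq_zero_of_notMem_tsupport fun hx' => hx (h.2.2 hx')

lemma IsTestFunction.memLp_top {n : ℕ} {Ω : Set (Euc n)} {φ : Euc n → ℝ}
    (h : IsTestFunction Ω φ) (μ : Measure (Euc n)) : MemLp φ ⊤ μ := by
  obtain ⟨C, hC⟩ := h.1.continuous.bounded_above_of_compact_support h.2.1
  exact memLp_top_of_bound h.1.continuous.aestronglyMeasurable C (ae_of_all _ hC)

lemma IsTestFunction.integral_mul_partialDeriv {n : ℕ} {Ω : Set (Euc n)} {φ ψ : Euc n → ℝ}
    (hφ : IsTestFunction Ω φ) (hψ : IsTestFunction Ω ψ) (j : Fin n) :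
    ∫ x in Ω, φ x * BiotRelaxation.partialDeriv j ψ x =
      -∫ x in Ω, BiotRelaxation.partialDeriv j φ x * ψ x := by
  have key : ∀ f g : Euc n → ℝ, IsTestFunction Ω f → IsTestFunction Ω g →
      Integrable (fun x => f x * g x) := fun f g hf hg =>
    hf.integrable.mul_of_top_left (hg.memLp_top volume)
  rw [setIntegral_eq_integral_of_forall_compl_eq_zero fun x hx => by rw [hφ.eq_zero hx, zero_mul],
    setIntegral_eq_integral_of_forall_compl_eq_zero fun x hx => by rw [hψ.eq_zero hx, mul_zero]]
  exact integral_mul_fderiv_eq_neg_fderiv_mul_of_integrable (key _ _ (hφ.partialDeriv j) hψ)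
    (key _ _ hφ (hψ.partialDeriv j)) (key _ _ hφ hψ)
    (fun x _ => (hφ.1.differentiable (by simp)).differentiableAt)
    (fun x _ => (hψ.1.differentiable (by simp)).differentiableAt)

lemma IsTestFunction.integral_partialDeriv {n : ℕ} {Ω : Set (Euc n)} {φ : Euc n → ℝ}
    (h : IsTestFunction Ω φ) (j : Fin n) :
    ∫ x in Ω, BiotRelaxation.partialDeriv j φ x = 0 := by
  rw [setIntegral_eq_integral_of_forall_compl_eq_zero fun x hx => (h.partialDeriv j).eq_zero hx]
  have := integral_mul_fderiv_eq_neg_fderiv_mul_of_integrable (μ := (volume : Measure (Euc n)))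
    (f := fun _ => (1 : ℝ)) (g := φ) (v := EuclideanSpace.single j 1) (by simp)
    (by
      simp only [one_mul]
      exact (h.partialDeriv j).integrable)
    (by simpa using h.integrable)
    (fun x _ => differentiableAt_const _)
    (fun x _ => (h.1.differentiable (by simp)).differentiableAt)
  simpa [BiotRelaxation.partialDeriv] using this

lemma partialDeriv_comm {n : ℕ} {φ : Euc n → ℝ} (h : ContDiff ℝ ∞ φ) (i j : Fin n) :
    partialDeriv i (partialDeriv j φ) = partialDeriv j (partialDeriv i φ) := by
  have key : ∀ i j : Fin n, ∀ x, partialDeriv i (partialDeriv j φ) x =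
      fderiv ℝ (fderiv ℝ φ) x (EuclideanSpace.single i 1) (EuclideanSpace.single j 1) := by
    intro i j x
    have hd : DifferentiableAt ℝ (fderiv ℝ φ) x :=
      ((h.fderiv_right (m := ∞) le_rfl).differentiable (by simp)).differentiableAt
    change fderiv ℝ (fun y => fderiv ℝ φ y (EuclideanSpace.single j 1)) x _ = _
    rw [fderiv_clm_apply hd (differentiableAt_const _)]
    simp
  ext x
  rw [key, key]
  exact (h.contDiffAt.isSymmSndFDerivAt (by simp; exact WithTop.coe_le_coe.2 le_top)) _ _

/-- Strong `L¹` convergence passes to the limit in integrals against bounded functions. -/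
lemma tendsto_integral_mul_of_memLp_top {α : Type*} [MeasurableSpace α] {μ : Measure α}
    {f : α → ℝ} {F : ℕ → α → ℝ} {h : α → ℝ} (hf : Integrable f μ) (hF : ∀ k, Integrable (F k) μ)
    (hh : MemLp h ⊤ μ) (hlim : Tendsto (fun k => ∫⁻ x, ‖F k x - f x‖ₑ ∂μ) atTop (𝓝 0)) :
    Tendsto (fun k => ∫ x, F k x * h x ∂μ) atTop (𝓝 (∫ x, f x * h x ∂μ)) := by
  refine tendsto_integral_of_L1 _ (hf.mul_of_top_left hh).aestronglyMeasurable
    (Eventually.of_forall fun k => (hF k).mul_of_top_left hh) ?_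
  have hC : eLpNormEssSup h μ ≠ ⊤ := by simpa using hh.2.ne
  have hz : Tendsto (fun k => (∫⁻ x, ‖F k x - f x‖ₑ ∂μ) * eLpNormEssSup h μ) atTop (𝓝 0) := by
    simpa using ENNReal.Tendsto.mul_const hlim (Or.inr hC)
  refine tendsto_of_tendsto_of_tendsto_of_le_of_le tendsto_const_nhds hz (fun _ => zero_le) ?_
  intro k
  dsimp only
  have hm : AEMeasurable (fun x => ‖F k x - f x‖ₑ) μ := ((hF k).sub hf).aestronglyMeasurable.enorm
  rw [← lintegral_mul_const'' _ hm]
  refine lintegral_mono_ae ?_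
  filter_upwards [enorm_ae_le_eLpNormEssSup h μ] with x hx
  rw [Pi.mul_apply, ← sub_mul, enorm_mul]
  gcongr

/-! ### Null Lagrangians on `W₀^{1,∞}` -/

section NullLagrangian

variable {n : ℕ} {Ω : Set (Euc n)} {u : Euc n → ℝ} {g : Euc n → Fin n → ℝ}

lemma IsSobolevZero.integrable_grad (h : IsSobolevZero Ω u g) (hΩ : volume Ω ≠ ⊤) (j : Fin n) :
    IntegrableOn (fun x => g x j) Ω := by
  have : IsFiniteMeasure (volume.restrict Ω) := ⟨by simpa using hΩ.lt_top⟩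
  exact (h.bounded_grad j).integrable le_top

lemma IsSobolevZero.integral_grad (h : IsSobolevZero Ω u g) (j : Fin n) :
    ∫ x in Ω, g x j = 0 := by
  obtain ⟨φ, hφ, -, h2⟩ := h.zero_boundary
  have := tendsto_integral_of_L1 (fun x => g x j) (h.bounded_grad j).1
    (Eventually.of_forall fun k => ((hφ k).partialDeriv j).integrable.integrableOn) (h2 j)
  simp only [(hφ _).integral_partialDeriv j] at this
  exact tendsto_nhds_unique this tendsto_const_nhds

/-- The `2 × 2` minors of a gradient with zero boundary values have mean zero. -/
lemma IsSobolevZero.integral_minor {v : Euc n → ℝ} {g' : Euc n → Fin n → ℝ}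
    (hu : IsSobolevZero Ω u g) (hv : IsSobolevZero Ω v g') (hΩ : volume Ω ≠ ⊤) (i j : Fin n) :
    ∫ x in Ω, g x i * g' x j - g x j * g' x i = 0 := by
  obtain ⟨φ, hφ, -, h2⟩ := hu.zero_boundary
  have hi : ∀ i j, IntegrableOn (fun x => g x i * g' x j) Ω := fun i j =>
    (hu.integrable_grad hΩ i).mul_of_top_left (hv.bounded_grad j)
  have lim : ∀ i j, Tendsto (fun k => ∫ x in Ω, partialDeriv i (φ k) x * g' x j) atTop
      (𝓝 (∫ x in Ω, g x i * g' x j)) := fun i j =>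
    tendsto_integral_mul_of_memLp_top (hu.integrable_grad hΩ i)
      (fun k => ((hφ k).partialDeriv i).integrable.integrableOn) (hv.bounded_grad j) (h2 i)
  -- Only `u` is approximated. Derivatives of its test functions are themselves test functions for
  -- the weak gradient of `v`, and symmetry of second derivatives then cancels the minor.
  have wk : ∀ i j k, ∫ x in Ω, partialDeriv i (φ k) x * g' x j =
      -∫ x in Ω, v x * partialDeriv j (partialDeriv i (φ k)) x := by
    intro i j k
    rw [hv.weak_grad _ ((hφ k).partialDeriv i) j, neg_neg]
    exact integral_congr_ae (ae_of_all _ fun x => mul_comm _ _)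
  have heq : ∀ k, ∫ x in Ω, partialDeriv i (φ k) x * g' x j =
      ∫ x in Ω, partialDeriv j (φ k) x * g' x i := by
    intro k
    rw [wk, wk, partialDeriv_comm (hφ k).1]
  rw [integral_sub (hi i j) (hi j i), sub_eq_zero]
  exact tendsto_nhds_unique (lim i j) ((tendsto_congr heq).2 (lim j i))

end NullLagrangian

/-! ### Extended real integrals -/

lemma coe_integral_eq_sub {n : ℕ} {Ω : Set (Euc n)} {g : Euc n → ℝ} (hg : IntegrableOn g Ω) :
    ((∫ x in Ω, g x : ℝ) : EReal) = extIntegral Ω fun x => (g x : EReal) := by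
  have hp : ∫⁻ x in Ω, ENNReal.ofReal (g x) ≠ ⊤ := hg.lintegral_lt_top.ne
  have hn : ∫⁻ x in Ω, ENNReal.ofReal (-g x) ≠ ⊤ := hg.neg.lintegral_lt_top.ne
  rw [integral_eq_lintegral_pos_part_sub_lintegral_neg_part hg, EReal.coe_sub,
    EReal.coe_ennreal_toReal hp, EReal.coe_ennreal_toReal hn]
  simp only [extIntegral, posInt, negInt, ← EReal.coe_neg, EReal.toENNReal_of_ne_top,
    ne_eq, EReal.coe_ne_top, not_false_eq_true, EReal.toReal_coe]

lemma posInt_mono {n : ℕ} (Ω : Set (Euc n)) {f g : Euc n → EReal} (h : ∀ x, f x ≤ g x) :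
    posInt Ω f ≤ posInt Ω g :=
  lintegral_mono fun x => EReal.toENNReal_le_toENNReal (h x)

lemma negInt_anti {n : ℕ} (Ω : Set (Euc n)) {f g : Euc n → EReal} (h : ∀ x, f x ≤ g x) :
    negInt Ω g ≤ negInt Ω f :=
  lintegral_mono fun x => EReal.toENNReal_le_toENNReal (EReal.neg_le_neg_iff.2 (h x))

lemma extIntegral_mono {n : ℕ} (Ω : Set (Euc n)) {f g : Euc n → EReal} (h : ∀ x, f x ≤ g x) :
    extIntegral Ω f ≤ extIntegral Ω g :=
  EReal.sub_le_sub (EReal.coe_ennreal_le_coe_ennreal_iff.2 (posInt_mono Ω h))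
    (EReal.coe_ennreal_le_coe_ennreal_iff.2 (negInt_anti Ω h))

/-! ### Polyconvexity implies quasiconvexity -/

/-- Every value of `w` is attained by a polyaffine function below `w`. -/
def HasPolyaffineMinorants (w : Mat 2 → ℝ) : Prop :=
  ∀ F, ∃ (L : Fin 2 → Fin 2 → ℝ) (c : ℝ), ∀ X : Mat 2,
    w F + ∑ i, ∑ j, L i j * X i j + c * X.det ≤ w (F + X)

/-- Null Lagrangian property: the entries of `G` and its determinant integrate to zero, so only the
constant survives. -/
lemma IsSobolevZeroVec.integral_polyaffine {Ω : Set (Euc 2)} {θ : Euc 2 → Euc 2}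
    {G : Euc 2 → Mat 2} (h : IsSobolevZeroVec Ω θ G) (hΩ : volume Ω ≠ ⊤) (a c : ℝ) (L : Fin 2 → Fin 2 → ℝ) :
    IntegrableOn (fun x => a + ∑ i, ∑ j, L i j * G x i j + c * (G x).det) Ω ∧
      ∫ x in Ω, a + ∑ i, ∑ j, L i j * G x i j + c * (G x).det = (volume Ω).toReal * a := by
  have hfin : IsFiniteMeasure (volume.restrict Ω) := ⟨by simpa using hΩ.lt_top⟩
  have i1 : IntegrableOn (fun x => ∑ i, ∑ j, L i j * G x i j) Ω :=
    integrable_finsetSum _ fun i _ => integrable_finsetSum _ fun j _ =>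
      ((h i).integrable_grad hΩ j).const_mul _
  have i2 : IntegrableOn (fun x => (G x).det) Ω := by
    simp only [Matrix.det_fin_two]
    have hi : ∀ i j, IntegrableOn (fun x => G x 0 i * G x 1 j) Ω := fun i j =>
      ((h 0).integrable_grad hΩ i).mul_of_top_left ((h 1).bounded_grad j)
    exact (hi 0 1).sub (hi 1 0)
  have e1 : ∫ x in Ω, ∑ i, ∑ j, L i j * G x i j = 0 := by
    refine (integral_finsetSum _ fun i _ => integrable_finsetSum _ fun j _ =>
      ((h i).integrable_grad hΩ j).const_mul _).trans ?_
    refine Finset.sum_eq_zero fun i _ => ?_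
    rw [integral_finsetSum _ fun j _ => ((h i).integrable_grad hΩ j).const_mul _]
    refine Finset.sum_eq_zero fun j _ => ?_
    rw [integral_const_mul, (h i).integral_grad, mul_zero]
  have e2 : ∫ x in Ω, (G x).det = 0 := by
    simp only [Matrix.det_fin_two]
    exact (h 0).integral_minor (h 1) hΩ 0 1
  have i0 : IntegrableOn (fun _ : Euc 2 => a) Ω := integrable_const _
  refine ⟨(i0.add i1).add (i2.const_mul c), ?_⟩
  have e3 := integral_add (i0.add i1) (i2.const_mul c)
  simp only [Pi.add_apply] at e3
  rw [e3, integral_add i0 i1, e1, integral_const_mul, e2]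
  simp [Measure.real]

lemma HasPolyaffineMinorants.mul_le_extIntegral {w : Mat 2 → ℝ} (hw : HasPolyaffineMinorants w)
    {Ω : Set (Euc 2)} {θ : Euc 2 → Euc 2} {G : Euc 2 → Mat 2} (h : IsSobolevZeroVec Ω θ G)
    (hΩ : volume Ω ≠ ⊤) (F : Mat 2) {f : Euc 2 → EReal} (hf : ∀ x, (w (F + G x) : EReal) ≤ f x) :
    (volume Ω : EReal) * w F ≤ extIntegral Ω f := by
  obtain ⟨L, c, hL⟩ := hw F
  obtain ⟨h1, h2⟩ := h.integral_polyaffine hΩ (w F) c L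
  rw [← EReal.coe_ennreal_toReal hΩ, ← EReal.coe_mul, ← h2, coe_integral_eq_sub h1]
  exact extIntegral_mono Ω fun x => (EReal.coe_le_coe_iff.2 (hL _)).trans (hf x)

lemma HasPolyaffineMinorants.quasiconvex {w : Mat 2 → ℝ} (hw : HasPolyaffineMinorants w) :
    Quasiconvex fun F => (w F : EReal) :=
  ⟨fun _ => EReal.coe_ne_bot _, fun _ _ hb _ F _ _ h _ =>
    hw.mul_le_extIntegral h hb.measure_lt_top.ne F fun _ => le_rfl⟩

lemma IsSobolevZeroVec.integral_det_add {Ω : Set (Euc 2)} {θ : Euc 2 → Euc 2}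
    {G : Euc 2 → Mat 2} (h : IsSobolevZeroVec Ω θ G) (hΩ : volume Ω ≠ ⊤) (F : Mat 2) :
    IntegrableOn (fun x => (F + G x).det) Ω ∧
      ∫ x in Ω, (F + G x).det = (volume Ω).toReal * F.det := by
  -- The matrix is the cofactor matrix of `F`: `det (F + G) = det F + cof F : G + det G`.
  have := h.integral_polyaffine hΩ F.det 1 ![![F 1 1, -F 1 0], ![-F 0 1, F 0 0]]
  convert this using 4
  all_goals
    simp [Matrix.det_fin_two, Fin.sum_univ_two]
    ring

/-- Where `det F > 0` the polyaffine minorant of `w` also lies below the extension. Where `det F ≤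
0` the left side may be `+∞`, and the mean of the determinant forces the right side to be `+∞` as
well. -/
lemma HasPolyaffineMinorants.quasiconvexGL {w : Mat 2 → ℝ} (hw : HasPolyaffineMinorants w) :
    QuasiconvexGL (restrictGL w) := by
  have hle : ∀ X, (w X : EReal) ≤ extendTop (restrictGL w) X := by
    intro X
    unfold extendTop restrictGL
    split_ifs <;> simp
  refine ⟨fun F hF => ?_, fun Ω _ hb _ F θ G h hint => ?_⟩
  · exact (EReal.bot_lt_coe (w F)).not_ge (hF ▸ hle F)
  have hΩ : volume Ω ≠ ⊤ := hb.measure_lt_top.ne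
  by_cases hF : 0 < F.det
  · have : extendTop (restrictGL w) F = w F := by simp [extendTop, hF, restrictGL]
    rw [this]
    exact hw.mul_le_extIntegral h hΩ F fun _ => hle _
  by_cases h0 : volume Ω = 0
  · have hr : volume.restrict Ω = 0 := by simpa using h0
    simp [h0, extIntegral, posInt, negInt, hr]
  -- Otherwise `det (F + G)` would be positive a.e. with integral `|Ω| det F ≤ 0`, which is
  -- impossible on a set of positive measure.
  have htop : posInt Ω (fun x => extendTop (restrictGL w) (F + G x)) = ⊤ := by
    refine lintegral_eq_top_of_measure_eq_top_ne_zero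
      (measurable_ereal_toENNReal.comp_aemeasurable hint.1) fun hz => ?_
    obtain ⟨hi, he⟩ := h.integral_det_add hΩ F
    have hpos : ∀ᵐ x ∂volume.restrict Ω, 0 < (F + G x).det := by
      rw [ae_iff]
      refine measure_mono_null (fun x hx => ?_) hz
      simp only [Set.mem_ofPred_eq] at hx ⊢
      simp [extendTop, hx]
    have hle0 : ∫ x in Ω, (F + G x).det ≤ 0 := by
      rw [he]
      exact mul_nonpos_of_nonneg_of_nonpos ENNReal.toReal_nonneg (not_lt.1 hF)
    have hz0 := (integral_eq_zero_iff_of_nonneg_ae (hpos.mono fun x hx => hx.le) hi).1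
      (le_antisymm hle0 (integral_nonneg_of_ae (hpos.mono fun x hx => hx.le)))
    have hfalse : ∀ᵐ x ∂volume.restrict Ω, False := by
      filter_upwards [hpos, hz0] with x hx hx'
      exact hx.ne' hx'
    rw [eventually_false_iff_eq_bot, ae_eq_bot, Measure.restrict_eq_zero] at hfalse
    exact h0 hfalse
  have hneg := hint.2.resolve_left (by simp [htop])
  have : extIntegral Ω (fun x => extendTop (restrictGL w) (F + G x)) = ⊤ := by
    rw [extIntegral, htop, ← EReal.coe_ennreal_toReal hneg]
    simp
  rw [this]
  exact le_top

/-! ### A smooth approximation of the positive part -/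

/-- A smooth approximation of the positive part, vanishing on `(-∞, δ]`. -/
noncomputable def cutoff (δ r : ℝ) : ℝ := ∫ u in (0 : ℝ)..r, Real.smoothTransition (u / δ - 1)

lemma contDiff_cutoff_integrand (δ : ℝ) :
    ContDiff ℝ ∞ fun u : ℝ => Real.smoothTransition (u / δ - 1) :=
  Real.smoothTransition.contDiff.comp ((contDiff_id.div_const δ).sub contDiff_const)

lemma hasDerivAt_cutoff (δ r : ℝ) :
    HasDerivAt (cutoff δ) (Real.smoothTransition (r / δ - 1)) r := by
  have hc := (contDiff_cutoff_integrand δ).continuous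
  exact intervalIntegral.integral_hasDerivAt_right (hc.intervalIntegrable _ _)
    (hc.stronglyMeasurableAtFilter _ _) hc.continuousAt

lemma contDiff_cutoff (δ : ℝ) : ContDiff ℝ ∞ (cutoff δ) := by
  refine contDiff_infty_iff_deriv.2 ⟨fun r => (hasDerivAt_cutoff δ r).differentiableAt, ?_⟩
  rw [show deriv (cutoff δ) = _ from funext fun r => (hasDerivAt_cutoff δ r).deriv]
  exact contDiff_cutoff_integrand δ

lemma cutoff_eq_zero {δ r : ℝ} (hδ : 0 < δ) (hr : r ≤ δ) : cutoff δ r = 0 := by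
  refine intervalIntegral.integral_zero_ae (ae_of_all _ fun u hu => ?_)
  refine Real.smoothTransition.zero_of_nonpos ?_
  have : u ≤ δ := by
    rcases Set.mem_uIoc.1 hu with h | h
    · exact h.2.trans hr
    · exact h.2.trans hδ.le
  rw [sub_nonpos, div_le_one hδ]
  exact this

lemma abs_cutoff_le {δ : ℝ} (hδ : 0 < δ) (r : ℝ) : |cutoff δ r| ≤ max r 0 := by
  rcases le_total r 0 with hr | hr
  · simp [cutoff_eq_zero hδ (hr.trans hδ.le)]
  · have := intervalIntegral.norm_integral_le_of_norm_le_const (a := 0) (b := r) (C := 1)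
      (f := fun u => Real.smoothTransition (u / δ - 1)) fun u _ => by
        rw [Real.norm_of_nonneg (Real.smoothTransition.nonneg _)]
        exact Real.smoothTransition.le_one _
    simpa [abs_of_nonneg hr, cutoff] using Or.inl this

/-- The integrand is `1` beyond `2 * δ`, so the error accumulates only on `[0, 2 * δ]`. -/
lemma abs_cutoff_sub_le {δ r : ℝ} (hδ : 0 < δ) (hr : 2 * δ ≤ r) : |cutoff δ r - r| ≤ 2 * δ := by
  have hc : ∀ a b, IntervalIntegrable (fun u => Real.smoothTransition (u / δ - 1)) volume a b :=
    fun a b => (contDiff_cutoff_integrand δ).continuous.intervalIntegrable a b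
  have h1 : ∫ u in (2 * δ)..r, Real.smoothTransition (u / δ - 1) = r - 2 * δ := by
    rw [intervalIntegral.integral_congr (g := fun _ => (1 : ℝ))]
    · simp
    · intro u hu
      rw [Set.uIcc_of_le hr] at hu
      refine Real.smoothTransition.one_of_one_le ?_
      have : 2 ≤ u / δ := (le_div_iff₀ hδ).2 hu.1
      linarith
  have h2 : cutoff δ r = cutoff δ (2 * δ) + (r - 2 * δ) := by
    rw [← h1]
    exact (intervalIntegral.integral_add_adjacent_intervals (hc _ _) (hc _ _)).symm
  have h3 := abs_cutoff_le hδ (2 * δ)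
  rw [max_eq_left (by linarith)] at h3
  have h4 : 0 ≤ cutoff δ (2 * δ) :=
    intervalIntegral.integral_nonneg (by linarith) fun u _ => Real.smoothTransition.nonneg _
  rw [abs_le] at h3 ⊢
  constructor <;> linarith

lemma tendsto_cutoff {δ ρ : ℕ → ℝ} {r : ℝ} (hδ : ∀ k, 0 < δ k) (hδ0 : Tendsto δ atTop (𝓝 0))
    (hρ : Tendsto ρ atTop (𝓝 r)) (hr : 0 < r) :
    Tendsto (fun k => cutoff (δ k) (ρ k)) atTop (𝓝 r) := by
  have h2 : Tendsto (fun k => 2 * δ k) atTop (𝓝 0) := by simpa using hδ0.const_mul 2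
  have hz : Tendsto (fun k => cutoff (δ k) (ρ k) - ρ k) atTop (𝓝 0) := by
    refine squeeze_zero_norm' ?_ h2
    filter_upwards [h2.eventually_lt hρ hr] with k hk
    exact abs_cutoff_sub_le (hδ k) hk.le
  simpa using hz.add hρ

lemma eventually_smoothTransition_eq_one {δ ρ : ℕ → ℝ} {r : ℝ} (hδ : ∀ k, 0 < δ k)
    (hδ0 : Tendsto δ atTop (𝓝 0)) (hρ : Tendsto ρ atTop (𝓝 r)) (hr : 0 < r) :
    ∀ᶠ k in atTop, Real.smoothTransition (ρ k / δ k - 1) = 1 := by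
  have h2 : Tendsto (fun k => 2 * δ k) atTop (𝓝 0) := by simpa using hδ0.const_mul 2
  filter_upwards [h2.eventually_lt hρ hr] with k hk
  refine Real.smoothTransition.one_of_one_le ?_
  have : 2 ≤ ρ k / δ k := (le_div_iff₀ (hδ k)).2 hk.le
  linarith

/-! ### A smooth approximation of the absolute value -/

/-- A smooth approximation of the absolute value. -/
noncomputable def smoothAbs (δ t : ℝ) : ℝ := √(t ^ 2 + δ ^ 2)

lemma abs_le_smoothAbs (δ t : ℝ) : |t| ≤ smoothAbs δ t :=
  Real.abs_le_sqrt (by nlinarith [sq_nonneg δ])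

lemma smoothAbs_pos {δ : ℝ} (hδ : 0 < δ) (t : ℝ) : 0 < smoothAbs δ t :=
  Real.sqrt_pos.2 (by positivity)

lemma contDiff_smoothAbs {δ : ℝ} (hδ : 0 < δ) : ContDiff ℝ ∞ (smoothAbs δ) :=
  ((contDiff_id.pow 2).add contDiff_const).sqrt fun t => by
    have : 0 < t ^ 2 + δ ^ 2 := by positivity
    exact this.ne'

lemma hasDerivAt_smoothAbs {δ : ℝ} (hδ : 0 < δ) (t : ℝ) :
    HasDerivAt (smoothAbs δ) (t / smoothAbs δ t) t := by
  have h := ((hasDerivAt_pow 2 t).add_const (δ ^ 2)).sqrt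
    (show (0 : ℝ) < t ^ 2 + δ ^ 2 by positivity).ne'
  refine h.congr_deriv ?_
  simp [smoothAbs, mul_div_mul_left]

lemma abs_div_smoothAbs_le {δ : ℝ} (hδ : 0 < δ) (t : ℝ) : |t / smoothAbs δ t| ≤ 1 := by
  rw [abs_div, abs_of_pos (smoothAbs_pos hδ t), div_le_one (smoothAbs_pos hδ t)]
  exact abs_le_smoothAbs δ t

lemma tendsto_smoothAbs {δ : ℕ → ℝ} (hδ0 : Tendsto δ atTop (𝓝 0)) (t : ℝ) :
    Tendsto (fun k => smoothAbs (δ k) t) atTop (𝓝 |t|) := by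
  have h : Tendsto (fun k => √(t ^ 2 + δ k ^ 2)) atTop (𝓝 √(t ^ 2 + 0 ^ 2)) :=
    ((hδ0.pow 2).const_add _).sqrt
  simpa [smoothAbs, Real.sqrt_sq_eq_abs] using h

/-! ### Membership in `W₀^{1,∞}` -/

section Sobolev

variable {n : ℕ} {Ω : Set (Euc n)} {u : Euc n → ℝ} {g : Euc n → Fin n → ℝ}

/-- The weak gradient of a `W^{1,1}`-limit of test functions is the limit of the gradients. -/
lemma IsSobolevZero.of_approx (hΩ : volume Ω ≠ ⊤) (hu : MemLp u ⊤ (volume.restrict Ω))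
    (hg : ∀ j, MemLp (fun x => g x j) ⊤ (volume.restrict Ω)) {φ : ℕ → Euc n → ℝ}
    (hφ : ∀ k, IsTestFunction Ω (φ k))
    (h0 : Tendsto (fun k => ∫⁻ x in Ω, ‖φ k x - u x‖ₑ) atTop (𝓝 0))
    (h1 : ∀ j, Tendsto (fun k => ∫⁻ x in Ω, ‖partialDeriv j (φ k) x - g x j‖ₑ) atTop (𝓝 0)) :
    IsSobolevZero Ω u g := by
  have : IsFiniteMeasure (volume.restrict Ω) := ⟨by simpa using hΩ.lt_top⟩
  refine ⟨hu, hg, fun ζ hζ j => ?_, φ, hφ, h0, h1⟩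
  have l0 := tendsto_integral_mul_of_memLp_top (hu.integrable le_top)
    (fun k => (hφ k).integrable.integrableOn) ((hζ.partialDeriv j).memLp_top _) h0
  have l1 := tendsto_integral_mul_of_memLp_top ((hg j).integrable le_top)
    (fun k => ((hφ k).partialDeriv j).integrable.integrableOn) (hζ.memLp_top _) (h1 j)
  simp only [(hφ _).integral_mul_partialDeriv hζ j] at l0
  exact tendsto_nhds_unique l0 l1.neg

lemma IsTestFunction.const_mul {φ : Euc n → ℝ} (h : IsTestFunction Ω φ) (c : ℝ) :
    IsTestFunction Ω fun x => c * φ x :=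
  ⟨contDiff_const.mul h.1, h.2.1.mul_left, (tsupport_mul_subset_right (f := fun _ => c)).trans h.2.2⟩

lemma partialDeriv_const_mul {φ : Euc n → ℝ} (h : ContDiff ℝ ∞ φ) (c : ℝ) (j : Fin n) (x : Euc n) :
    partialDeriv j (fun x => c * φ x) x = c * partialDeriv j φ x := by
  rw [partialDeriv, fderiv_const_mul (h.differentiable (by simp)).differentiableAt]
  rfl

lemma IsSobolevZero.const_mul (h : IsSobolevZero Ω u g) (hΩ : volume Ω ≠ ⊤) (c : ℝ) :
    IsSobolevZero Ω (fun x => c * u x) fun x j => c * g x j := by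
  obtain ⟨φ, hφ, h0, h1⟩ := h.zero_boundary
  have key : ∀ a : ℕ → ENNReal, Tendsto a atTop (𝓝 0) →
      Tendsto (fun k => ‖c‖ₑ * a k) atTop (𝓝 0) := fun a ha => by
    simpa using ENNReal.Tendsto.const_mul ha (Or.inr (enorm_ne_top (x := c)))
  refine .of_approx hΩ (h.bounded.const_mul c) (fun j => (h.bounded_grad j).const_mul c)
    (fun k => (hφ k).const_mul c) ?_ fun j => ?_
  · refine (tendsto_congr fun k => ?_).2 (key _ h0)
    rw [← lintegral_const_mul' _ _ enorm_ne_top]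
    simp only [← mul_sub, enorm_mul]
  · refine (tendsto_congr fun k => ?_).2 (key _ (h1 j))
    rw [← lintegral_const_mul' _ _ enorm_ne_top]
    simp only [partialDeriv_const_mul (hφ k).1, ← mul_sub, enorm_mul]

end Sobolev

lemma tendsto_lintegral_enorm_sub_of_bounded {α : Type*} [MeasurableSpace α] {μ : Measure α}
    [IsFiniteMeasure μ] {F : ℕ → α → ℝ} {f : α → ℝ} {C : ℝ} (hF : ∀ k, AEStronglyMeasurable (F k) μ)
    (hb : ∀ k, ∀ᵐ x ∂μ, |F k x| ≤ C) (hlim : ∀ᵐ x ∂μ, Tendsto (fun k => F k x) atTop (𝓝 (f x))) :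
    Tendsto (fun k => ∫⁻ x, ‖F k x - f x‖ₑ ∂μ) atTop (𝓝 0) := by
  have := tendsto_lintegral_norm_of_dominated_convergence hF
    (hasFiniteIntegral_const C : HasFiniteIntegral (fun _ => C) μ) hb hlim
  simpa only [ofReal_norm] using this

/-! ### Tent functions on a plane rhomboid -/

/-- The linear form on the plane with coefficients `p`. -/
noncomputable def linForm (p : Fin 2 → ℝ) : Euc 2 →L[ℝ] ℝ := ∑ i, p i • EuclideanSpace.proj i

@[simp] lemma linForm_single (p : Fin 2 → ℝ) (j : Fin 2) :
    linForm p (EuclideanSpace.single j 1) = p j := by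
  fin_cases j <;> simp [linForm]

lemma linForm_apply (p : Fin 2 → ℝ) (x : Euc 2) : linForm p x = p 0 * x 0 + p 1 * x 1 := by
  simp [linForm]

/-- A concave piecewise affine function with four gradients. -/
noncomputable def tent (m k : ℝ) (p q : Fin 2 → ℝ) (x : Euc 2) : ℝ :=
  1 - m * linForm p x - k * |linForm p x| - |linForm q x|

/-- The gradient of `tent`. -/
noncomputable def tentGrad (m k : ℝ) (p q : Fin 2 → ℝ) (x : Euc 2) (j : Fin 2) : ℝ :=
  (if 0 < linForm p x then -(m + k) else -(m - k)) * p j +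
    (if 0 < linForm q x then -1 else 1) * q j

/-- The domain on which `tent` is positive. -/
noncomputable def tentDomain (m k : ℝ) (p q : Fin 2 → ℝ) : Set (Euc 2) := {x | 0 < tent m k p q x}

/-- A smooth approximation of `tent` from below. -/
noncomputable def smoothTent (m k : ℝ) (p q : Fin 2 → ℝ) (δ : ℝ) (x : Euc 2) : ℝ :=
  1 - m * linForm p x - k * smoothAbs δ (linForm p x) - smoothAbs δ (linForm q x)

section Tent

variable {m k : ℝ} {p q : Fin 2 → ℝ}

lemma continuous_tent : Continuous (tent m k p q) := by
  unfold tent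
  fun_prop

lemma isOpen_tentDomain : IsOpen (tentDomain m k p q) :=
  isOpen_lt continuous_const continuous_tent

/-- The tent is concave. Convexity gives the null boundary required of the domains in `Quasiconvex`.
-/
lemma convex_tentDomain (hk : 0 ≤ k) : Convex ℝ (tentDomain m k p q) := by
  intro x hx y hy a b ha hb hab
  simp only [tentDomain, tent, Set.mem_ofPred_eq, map_add, map_smul, smul_eq_mul] at *
  have key : ∀ s t : ℝ, |a * s + b * t| ≤ a * |s| + b * |t| := fun s t => by
    simpa [abs_mul, abs_of_nonneg ha, abs_of_nonneg hb] using abs_add_le (a * s) (b * t)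
  have h1 := mul_le_mul_of_nonneg_left (key (linForm p x) (linForm p y)) hk
  have h2 := key (linForm q x) (linForm q y)
  obtain rfl : b = 1 - a := by linarith
  rcases ha.eq_or_lt with rfl | ha'
  · simp at *
    linarith
  · nlinarith [mul_pos ha' hx, mul_nonneg hb hy.le]

lemma volume_frontier_tentDomain (hk : 0 ≤ k) : volume (frontier (tentDomain m k p q)) = 0 :=
  (convex_tentDomain hk).addHaar_frontier volume

/-- For `|m| < k` the term `m * s + k * |s|` is at least `(k - |m|) * |s|`, so positivity of the
tent bounds both linear forms. -/
lemma tentDomain_bounds (hmk : |m| < k) {x : Euc 2} (hx : x ∈ tentDomain m k p q) :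
    |linForm p x| ≤ 1 / (k - |m|) ∧ |linForm q x| ≤ 1 := by
  simp only [tentDomain, tent, Set.mem_ofPred_eq] at hx
  have h1 : -(|m| * |linForm p x|) ≤ m * linForm p x := by
    rw [← abs_mul]
    exact neg_abs_le _
  have h2 : 0 ≤ (k - |m|) * |linForm p x| := mul_nonneg (by linarith) (abs_nonneg _)
  constructor
  · rw [le_div_iff₀ (by linarith)]
    nlinarith [abs_nonneg (linForm q x)]
  · nlinarith

lemma isBounded_tentDomain (hmk : |m| < k) (hpq : p 0 * q 1 - p 1 * q 0 ≠ 0) :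
    Bornology.IsBounded (tentDomain m k p q) := by
  have hinj : LinearMap.ker ((linForm p).prod (linForm q)).toLinearMap = ⊥ := by
    rw [LinearMap.ker_eq_bot']
    intro x hx
    have h1 : p 0 * x 0 + p 1 * x 1 = 0 := by
      simpa [linForm_apply] using congrArg Prod.fst hx
    have h2 : q 0 * x 0 + q 1 * x 1 = 0 := by
      simpa [linForm_apply] using congrArg Prod.snd hx
    have e0 : x 0 = 0 := by
      refine (mul_eq_zero.1 (?_ : (p 0 * q 1 - p 1 * q 0) * x 0 = 0)).resolve_left hpq
      linear_combination q 1 * h1 - p 1 * h2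
    have e1 : x 1 = 0 := by
      refine (mul_eq_zero.1 (?_ : (p 0 * q 1 - p 1 * q 0) * x 1 = 0)).resolve_left hpq
      linear_combination p 0 * h2 - q 0 * h1
    ext i
    fin_cases i
    · exact e0
    · exact e1
  obtain ⟨K, -, hK⟩ := LinearMap.exists_antilipschitzWith _ hinj
  refine (hK.isBounded_preimage (Metric.isBounded_closedBall (x := 0)
    (r := max (1 / (k - |m|)) 1))).subset fun x hx => ?_
  obtain ⟨h1, h2⟩ := tentDomain_bounds hmk hx
  rw [Set.mem_preimage, mem_closedBall_zero_iff]
  exact max_le (h1.trans (le_max_left _ _)) (h2.trans (le_max_right _ _))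

lemma tent_le_one (hmk : |m| < k) (x : Euc 2) : tent m k p q x ≤ 1 := by
  have h1 : -(|m| * |linForm p x|) ≤ m * linForm p x := by
    rw [← abs_mul]
    exact neg_abs_le _
  have h2 : 0 ≤ (k - |m|) * |linForm p x| := mul_nonneg (by linarith) (abs_nonneg _)
  unfold tent
  nlinarith [abs_nonneg (linForm q x)]

lemma smoothTent_le_tent (hk : 0 ≤ k) (δ : ℝ) (x : Euc 2) :
    smoothTent m k p q δ x ≤ tent m k p q x := by
  have h1 := mul_le_mul_of_nonneg_left (abs_le_smoothAbs δ (linForm p x)) hk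
  have h2 := abs_le_smoothAbs δ (linForm q x)
  unfold smoothTent tent
  linarith

lemma contDiff_smoothTent {δ : ℝ} (hδ : 0 < δ) : ContDiff ℝ ∞ (smoothTent m k p q δ) := by
  have h := contDiff_smoothAbs hδ
  unfold smoothTent
  exact ((contDiff_const.sub (contDiff_const.mul (linForm p).contDiff)).sub
    (contDiff_const.mul (h.comp (linForm p).contDiff))).sub (h.comp (linForm q).contDiff)

/-- The smoothed tent lies below the tent and the cutoff kills values up to `δ`, so the support
stays in a closed set strictly inside the domain. -/
lemma isTestFunction_cutoff_smoothTent (hmk : |m| < k) (hpq : p 0 * q 1 - p 1 * q 0 ≠ 0) {δ : ℝ}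
    (hδ : 0 < δ) :
    IsTestFunction (tentDomain m k p q) fun x => cutoff δ (smoothTent m k p q δ x) := by
  have hsub : {x | δ ≤ smoothTent m k p q δ x} ⊆ tentDomain m k p q := fun x hx =>
    hδ.trans_le (le_trans hx (smoothTent_le_tent ((abs_nonneg m).trans hmk.le) δ x))
  have hcl : IsClosed {x | δ ≤ smoothTent m k p q δ x} :=
    isClosed_le continuous_const (contDiff_smoothTent hδ).continuous
  have hz : ∀ x ∉ {x | δ ≤ smoothTent m k p q δ x}, cutoff δ (smoothTent m k p q δ x) = 0 :=
    fun x hx => cutoff_eq_zero hδ (not_le.1 hx).le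
  refine ⟨(contDiff_cutoff δ).comp (contDiff_smoothTent hδ), ?_, ?_⟩
  · exact .intro (Metric.isCompact_of_isClosed_isBounded hcl
      ((isBounded_tentDomain hmk hpq).subset hsub)) hz
  · refine (closure_minimal (fun x hx => ?_) hcl).trans hsub
    by_contra h
    exact hx (hz x h)

lemma partialDeriv_cutoff_smoothTent {δ : ℝ} (hδ : 0 < δ) (j : Fin 2) (x : Euc 2) :
    partialDeriv j (fun x => cutoff δ (smoothTent m k p q δ x)) x =
      Real.smoothTransition (smoothTent m k p q δ x / δ - 1) *
        (-(m * p j) - k * (linForm p x / smoothAbs δ (linForm p x) * p j) -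
          linForm q x / smoothAbs δ (linForm q x) * q j) := by
  have hp := (linForm p).hasFDerivAt (x := x)
  have hq := (linForm q).hasFDerivAt (x := x)
  have h1 := (hasDerivAt_smoothAbs hδ (linForm p x)).comp_hasFDerivAt x hp
  have h2 := (hasDerivAt_smoothAbs hδ (linForm q x)).comp_hasFDerivAt x hq
  have h3 : HasFDerivAt (smoothTent m k p q δ) _ x :=
    (((hp.const_mul m).const_sub 1).sub (h1.const_mul k)).sub h2
  have h4 := (hasDerivAt_cutoff δ (smoothTent m k p q δ x)).comp_hasFDerivAt x h3
  rw [partialDeriv, show (fun x => cutoff δ (smoothTent m k p q δ x)) =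
    cutoff δ ∘ smoothTent m k p q δ from rfl, h4.fderiv]
  simp

lemma ae_linForm_ne_zero (hp : p ≠ 0) : ∀ᵐ x, linForm p x ≠ 0 := by
  have h : LinearMap.ker (linForm p).toLinearMap ≠ ⊤ := by
    intro h
    refine hp (funext fun j => ?_)
    have : EuclideanSpace.single j (1 : ℝ) ∈ LinearMap.ker (linForm p).toLinearMap := by
      rw [h]
      trivial
    simpa using this
  rw [ae_iff]
  simpa using! Measure.addHaar_submodule volume _ h

lemma measurable_tentGrad (j : Fin 2) : Measurable fun x => tentGrad m k p q x j := by
  have hp : MeasurableSet {x | 0 < linForm p x} :=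
    measurableSet_lt measurable_const (linForm p).continuous.measurable
  have hq : MeasurableSet {x | 0 < linForm q x} :=
    measurableSet_lt measurable_const (linForm q).continuous.measurable
  exact ((Measurable.ite hp measurable_const measurable_const).mul_const _).add
    ((Measurable.ite hq measurable_const measurable_const).mul_const _)

lemma abs_tentGrad_le (hk : 0 ≤ k) (x : Euc 2) (j : Fin 2) :
    |tentGrad m k p q x j| ≤ (|m| + k) * |p j| + |q j| := by
  unfold tentGrad
  refine (abs_add_le _ _).trans ?_
  rw [abs_mul, abs_mul]
  gcongr
  · split_ifs
    · rw [abs_neg]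
      exact (abs_add_le _ _).trans (by rw [abs_of_nonneg hk])
    · rw [abs_neg]
      exact (abs_sub _ _).trans (by rw [abs_of_nonneg hk])
  · split_ifs <;> simp

/-- The cut-off smoothed tents converge by dominated convergence. At each point of the domain the
cutoff eventually has slope one, and off the two null lines where a linear form vanishes the
derivatives of `smoothAbs` tend to the sign. -/
lemma isSobolevZero_tent (hmk : |m| < k) (hpq : p 0 * q 1 - p 1 * q 0 ≠ 0) :
    IsSobolevZero (tentDomain m k p q) (tent m k p q) (tentGrad m k p q) := by
  have hk : 0 ≤ k := (abs_nonneg m).trans hmk.le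
  have hΩ : volume (tentDomain m k p q) ≠ ⊤ := (isBounded_tentDomain hmk hpq).measure_lt_top.ne
  have hfin : IsFiniteMeasure (volume.restrict (tentDomain m k p q)) :=
    ⟨by simpa using hΩ.lt_top⟩
  have hmem : ∀ᵐ x ∂volume.restrict (tentDomain m k p q), x ∈ tentDomain m k p q :=
    ae_restrict_mem isOpen_tentDomain.measurableSet
  set δ : ℕ → ℝ := fun i => 1 / ((i : ℝ) + 1) with hδdef
  have hδ : ∀ i, 0 < δ i := fun i => by positivity
  have hδ0 : Tendsto δ atTop (𝓝 0) := tendsto_one_div_add_atTop_nhds_zero_nat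
  have htest := fun i => isTestFunction_cutoff_smoothTent hmk hpq (hδ i)
  have hlim : ∀ x, Tendsto (fun i => smoothTent m k p q (δ i) x) atTop (𝓝 (tent m k p q x)) :=
    fun x => (((tendsto_smoothAbs hδ0 _).const_mul k).const_sub _).sub (tendsto_smoothAbs hδ0 _)
  refine .of_approx hΩ ?_ (fun j => ?_) htest ?_ fun j => ?_
  · refine memLp_top_of_bound continuous_tent.aestronglyMeasurable 1 ?_
    filter_upwards [hmem] with x hx
    rw [Real.norm_of_nonneg (le_of_lt hx)]
    exact tent_le_one hmk x
  · exact memLp_top_of_bound (measurable_tentGrad j).aestronglyMeasurable _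
      (ae_of_all _ fun x => abs_tentGrad_le hk x j)
  · refine tendsto_lintegral_enorm_sub_of_bounded (C := 1)
      (fun i => (htest i).1.continuous.aestronglyMeasurable) (fun i => ae_of_all _ fun x => ?_) ?_
    · exact (abs_cutoff_le (hδ i) _).trans
        (max_le ((smoothTent_le_tent hk _ x).trans (tent_le_one hmk x)) zero_le_one)
    · filter_upwards [hmem] with x hx
      exact tendsto_cutoff hδ hδ0 (hlim x) hx
  · refine tendsto_lintegral_enorm_sub_of_bounded (C := |m * p j| + k * |p j| + |q j|)
      (fun i => ((htest i).partialDeriv j).1.continuous.aestronglyMeasurable)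
      (fun i => ae_of_all _ fun x => ?_) ?_
    · rw [partialDeriv_cutoff_smoothTent (hδ i), abs_mul,
        abs_of_nonneg (Real.smoothTransition.nonneg _)]
      refine (mul_le_of_le_one_left (abs_nonneg _) (Real.smoothTransition.le_one _)).trans ?_
      refine (abs_sub _ _).trans (add_le_add ((abs_sub _ _).trans (add_le_add (by simp) ?_)) ?_)
      · rw [abs_mul, abs_mul, abs_of_nonneg hk]
        exact mul_le_mul_of_nonneg_left
          (mul_le_of_le_one_left (abs_nonneg _) (abs_div_smoothAbs_le (hδ i) _)) hk
      · rw [abs_mul]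
        exact mul_le_of_le_one_left (abs_nonneg _) (abs_div_smoothAbs_le (hδ i) _)
    · have hp : p ≠ 0 := by
        rintro rfl
        simp at hpq
      have hq : q ≠ 0 := by
        rintro rfl
        simp at hpq
      filter_upwards [hmem, ae_restrict_of_ae (ae_linForm_ne_zero hp),
        ae_restrict_of_ae (ae_linForm_ne_zero hq)] with x hx hpx hqx
      simp only [partialDeriv_cutoff_smoothTent (hδ _)]
      have key : ∀ t : ℝ, t ≠ 0 → Tendsto (fun i => t / smoothAbs (δ i) t) atTop (𝓝 (t / |t|)) :=
        fun t ht => tendsto_const_nhds.div (tendsto_smoothAbs hδ0 t) (abs_ne_zero.2 ht)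
      have hsgn : ∀ t : ℝ, t ≠ 0 → t / |t| = if 0 < t then 1 else -1 := by
        intro t ht
        split_ifs with h
        · rw [abs_of_pos h, div_self ht]
        · rw [abs_of_nonpos (not_lt.1 h), div_neg, div_self ht]
      have hl : Tendsto (fun i => Real.smoothTransition (smoothTent m k p q (δ i) x / δ i - 1))
          atTop (𝓝 1) := tendsto_const_nhds.congr'
        ((eventually_smoothTransition_eq_one hδ hδ0 (hlim x) hx).mono fun i hi => hi.symm)
      have := hl.mul ((((((key _ hpx).mul_const (p j)).const_mul k).const_sub (-(m * p j)))).sub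
        ((key _ hqx).mul_const (q j)))
      convert this using 2
      rw [hsgn _ hpx, hsgn _ hqx, tentGrad]
      split_ifs <;> ring

end Tent

/-! ### Lamination -/

/-- A quasiconvex function lies below the common bound at the two ends of a rank-one segment. -/
lemma Quasiconvex.le_of_lamination {w : Mat 2 → EReal} (hw : Quasiconvex w) {F : Mat 2}
    {c a : Fin 2 → ℝ} (ha : a ≠ 0) {t₁ t₂ v : ℝ} (h₁ : t₁ < 0) (h₂ : 0 < t₂)
    (hv₁ : ∀ r : ℝ, v < r → ∀ᶠ X in 𝓝 (F + t₁ • Matrix.vecMulVec c a), w X ≤ r)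
    (hv₂ : ∀ r : ℝ, v < r → ∀ᶠ X in 𝓝 (F + t₂ • Matrix.vecMulVec c a), w X ≤ r) :
    w F ≤ v := by
  refine le_of_forall_gt fun z hz => ?_
  obtain ⟨r, hr, hrz⟩ := EReal.lt_iff_exists_real_btwn.1 hz
  refine lt_of_le_of_lt ?_ hrz
  rw [EReal.coe_lt_coe_iff] at hr
  -- `b` is orthogonal to `a`. A small slope `±η` along `b` makes the domain bounded, while the four
  -- gradients stay close to the two end points. Since both ends share the bound `v`, volume
  -- fractions play no role.
  set b : Fin 2 → ℝ := ![-a 1, a 0] with hb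
  have hev : ∀ t e : ℝ, (∀ᶠ X in 𝓝 (F + t • Matrix.vecMulVec c a), w X ≤ r) →
      ∀ᶠ η in 𝓝[>] (0 : ℝ),
        w (F + (t • Matrix.vecMulVec c a + (e * η) • Matrix.vecMulVec c b)) ≤ r := by
    intro t e h
    have hc : Continuous fun η : ℝ =>
        F + (t • Matrix.vecMulVec c a + (e * η) • Matrix.vecMulVec c b) := by fun_prop
    have := hc.tendsto 0
    simp only [mul_zero, zero_smul, add_zero] at this
    exact (this.mono_left nhdsWithin_le_nhds).eventually h
  obtain ⟨η, hη, hA, hB, hC, hD⟩ := (eventually_mem_nhdsWithin.and <|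
    (hev t₁ (-1) (hv₁ r hr)).and <| (hev t₁ 1 (hv₁ r hr)).and <|
    (hev t₂ (-1) (hv₂ r hr)).and (hev t₂ 1 (hv₂ r hr))).exists
  replace hη : 0 < η := hη
  -- Chosen so that the two slopes `-(m + k)` and `-(m - k)` of the tent along `a` are `t₁` and
  -- `t₂`; `t₁ < 0 < t₂` amounts to `|m| < k`.
  set m := -(t₁ + t₂) / 2 with hm
  set k := (t₂ - t₁) / 2 with hkdef
  have hmk : |m| < k := by
    rw [abs_lt]
    constructor <;> linarith
  have hpq : a 0 * (η • b) 1 - a 1 * (η • b) 0 ≠ 0 := by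
    have : a 0 ^ 2 + a 1 ^ 2 ≠ 0 := by
      intro h
      refine ha (funext fun i => ?_)
      have h0 : a 0 = 0 := by nlinarith [sq_nonneg (a 0), sq_nonneg (a 1)]
      have h1 : a 1 = 0 := by nlinarith [sq_nonneg (a 0), sq_nonneg (a 1)]
      fin_cases i
      · exact h0
      · exact h1
    have h : a 0 * (η • b) 1 - a 1 * (η • b) 0 = η * (a 0 ^ 2 + a 1 ^ 2) := by
      simp [hb]
      ring
    rw [h]
    exact mul_ne_zero hη.ne' this
  set Ω := tentDomain m k a (η • b)
  have hbd : Bornology.IsBounded Ω := isBounded_tentDomain hmk hpq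
  have hΩ : volume Ω ≠ ⊤ := hbd.measure_lt_top.ne
  have hΩ0 : 0 < (volume Ω).toReal := ENNReal.toReal_pos
    (isOpen_tentDomain.measure_pos volume ⟨0, by simp [tentDomain, tent]⟩).ne' hΩ
  have hsob : IsSobolevZeroVec Ω (fun x => WithLp.toLp 2 fun i => c i * tent m k a (η • b) x)
      (fun x => Matrix.of fun i j => c i * tentGrad m k a (η • b) x j) :=
    fun i => (isSobolevZero_tent hmk hpq).const_mul hΩ (c i)
  have hval : ∀ x, F + Matrix.of (fun i j => c i * tentGrad m k a (η • b) x j) =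
      F + ((if 0 < linForm a x then t₁ else t₂) • Matrix.vecMulVec c a +
        ((if 0 < linForm (η • b) x then -1 else 1) * η) • Matrix.vecMulVec c b) := by
    intro x
    congr 1
    have e1 : -(m + k) = t₁ := by simp only [hm, hkdef]; ring
    have e2 : -(m - k) = t₂ := by simp only [hm, hkdef]; ring
    ext i j
    simp only [tentGrad, e1, e2, Matrix.of_apply, Matrix.add_apply, Matrix.smul_apply,
      Matrix.vecMulVec_apply, smul_eq_mul, Pi.smul_apply]
    ring
  have hle : ∀ x, w (F + Matrix.of (fun i j => c i * tentGrad m k a (η • b) x j)) ≤ (r : EReal) := by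
    intro x
    rw [hval]
    split_ifs <;> assumption
  have hpS : MeasurableSet {x | 0 < linForm a x} :=
    measurableSet_lt measurable_const (linForm a).continuous.measurable
  have hqS : MeasurableSet {x | 0 < linForm (η • b) x} :=
    measurableSet_lt measurable_const (linForm (η • b)).continuous.measurable
  -- `w` need not be measurable: the composition takes only four values, each on a measurable piece.
  have hmeas : Measurable fun x =>
      w (F + Matrix.of (fun i j => c i * tentGrad m k a (η • b) x j)) := by
    have : (fun x => w (F + Matrix.of (fun i j => c i * tentGrad m k a (η • b) x j))) =
        fun x => if 0 < linForm a x then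
          (if 0 < linForm (η • b) x then
            w (F + (t₁ • Matrix.vecMulVec c a + (-1 * η) • Matrix.vecMulVec c b))
          else w (F + (t₁ • Matrix.vecMulVec c a + (1 * η) • Matrix.vecMulVec c b)))
        else (if 0 < linForm (η • b) x then
            w (F + (t₂ • Matrix.vecMulVec c a + (-1 * η) • Matrix.vecMulVec c b))
          else w (F + (t₂ • Matrix.vecMulVec c a + (1 * η) • Matrix.vecMulVec c b))) := by
      ext x
      rw [hval]
      split_ifs <;> rfl
    rw [this]
    exact Measurable.ite hpS (Measurable.ite hqS measurable_const measurable_const)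
      (Measurable.ite hqS measurable_const measurable_const)
  have hconst : IntegrableOn (fun _ : Euc 2 => r) Ω := integrableOn_const hΩ
  have hint : posInt Ω (fun x =>
      w (F + Matrix.of (fun i j => c i * tentGrad m k a (η • b) x j))) ≠ ⊤ := by
    refine ((posInt_mono Ω hle).trans_lt ?_).ne
    simp only [posInt, lintegral_const, Measure.restrict_apply_univ]
    exact ENNReal.mul_lt_top (by simp [EReal.toENNReal_of_ne_top]) hΩ.lt_top
  have hq := hw.2 Ω isOpen_tentDomain hbd
    (volume_frontier_tentDomain ((abs_nonneg m).trans hmk.le)) F _ _ hsob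
    ⟨hmeas.aemeasurable, Or.inl hint⟩
  have hq' := hq.trans (extIntegral_mono Ω hle)
  rw [← coe_integral_eq_sub hconst, ← EReal.coe_ennreal_toReal hΩ] at hq'
  simp only [integral_const, Measure.real, Measure.restrict_apply_univ, smul_eq_mul] at hq'
  induction h : w F with
  | bot => exact bot_le
  | top =>
    rw [h, EReal.coe_mul_top_of_pos hΩ0] at hq'
    exact absurd hq' (not_le.2 (EReal.coe_lt_top _))
  | coe y =>
    rw [h, ← EReal.coe_mul, EReal.coe_le_coe_iff] at hq'
    exact EReal.coe_le_coe_iff.2 (le_of_mul_le_mul_left hq' hΩ0)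

/-! ### Conformal and anticonformal parts of a plane matrix -/

/-- Twice the modulus of the conformal part. -/
noncomputable def conf (X : Mat 2) : ℝ := √((X 0 0 + X 1 1) ^ 2 + (X 1 0 - X 0 1) ^ 2)

/-- Twice the modulus of the anticonformal part. -/
noncomputable def anticonf (X : Mat 2) : ℝ := √((X 0 0 - X 1 1) ^ 2 + (X 1 0 + X 0 1) ^ 2)

lemma frobSq_two (X : Mat 2) :
    frobSq X = X 0 0 ^ 2 + X 0 1 ^ 2 + X 1 0 ^ 2 + X 1 1 ^ 2 := by
  simp [frobSq, Fin.sum_univ_two]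
  ring

lemma conf_sq (X : Mat 2) : conf X ^ 2 = frobSq X + 2 * X.det := by
  rw [conf, Real.sq_sqrt (by positivity), frobSq_two, Matrix.det_fin_two]
  ring

lemma anticonf_sq (X : Mat 2) : anticonf X ^ 2 = frobSq X - 2 * X.det := by
  rw [anticonf, Real.sq_sqrt (by positivity), frobSq_two, Matrix.det_fin_two]
  ring

lemma conf_nonneg (X : Mat 2) : 0 ≤ conf X := Real.sqrt_nonneg _

lemma anticonf_nonneg (X : Mat 2) : 0 ≤ anticonf X := Real.sqrt_nonneg _

lemma conf_eq_sqrt (X : Mat 2) : conf X = √(frobSq X + 2 * X.det) := by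
  rw [← conf_sq, Real.sqrt_sq (conf_nonneg X)]

lemma anticonf_eq_sqrt (X : Mat 2) : anticonf X = √(frobSq X - 2 * X.det) := by
  rw [← anticonf_sq, Real.sqrt_sq (anticonf_nonneg X)]

lemma continuous_conf : Continuous conf := by
  have h : ∀ i j, Continuous fun X : Mat 2 => X i j := fun i j => continuous_id.matrix_elem i j
  exact ((((h 0 0).add (h 1 1)).pow 2).add (((h 1 0).sub (h 0 1)).pow 2)).sqrt

lemma continuous_frobSq {n : ℕ} : Continuous fun X : Mat n => frobSq X :=
  continuous_finsetSum _ fun i _ => continuous_finsetSum _ fun j _ =>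
    (continuous_id.matrix_elem i j).pow 2

/-! ### The two energies in closed form -/

lemma le_sqrt_sq_add_sq {c s : ℝ} (h : c ^ 2 + s ^ 2 = 1) (u v : ℝ) :
    c * u + s * v ≤ √(u ^ 2 + v ^ 2) := by
  refine (le_abs_self _).trans (Real.abs_le_sqrt ?_)
  have : u ^ 2 + v ^ 2 = (c ^ 2 + s ^ 2) * (u ^ 2 + v ^ 2) := by rw [h, one_mul]
  nlinarith [sq_nonneg (c * v - s * u)]

/-- For the rotation with first column `(c, s)`, `‖X - R‖² = ‖X‖² + 2 - 2 (c (X₀₀ + X₁₁) + s (X₁₀ -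
X₀₁))`, and Cauchy–Schwarz gives the optimal pair. -/
lemma wDist_eq (X : Mat 2) : wDist X = frobSq X + 2 - 2 * conf X := by
  refine le_antisymm ?_ (le_ciInf fun R => ?_)
  · obtain ⟨c, s, hcs, h⟩ : ∃ c s : ℝ, c ^ 2 + s ^ 2 = 1 ∧
        c * (X 0 0 + X 1 1) + s * (X 1 0 - X 0 1) = conf X := by
      rcases (conf_nonneg X).eq_or_lt with h0 | h0
      · have hz : (X 0 0 + X 1 1) ^ 2 + (X 1 0 - X 0 1) ^ 2 = 0 :=
          (Real.sqrt_eq_zero (by positivity)).1 h0.symm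
        refine ⟨1, 0, by norm_num, ?_⟩
        rw [← h0, one_mul, zero_mul, add_zero]
        nlinarith [sq_nonneg (X 0 0 + X 1 1), sq_nonneg (X 1 0 - X 0 1)]
      · have hsq : conf X ^ 2 = (X 0 0 + X 1 1) ^ 2 + (X 1 0 - X 0 1) ^ 2 :=
          Real.sq_sqrt (by positivity)
        refine ⟨(X 0 0 + X 1 1) / conf X, (X 1 0 - X 0 1) / conf X, ?_, ?_⟩
        · rw [div_pow, div_pow, ← add_div, ← hsq, div_self (by positivity)]
        · field_simp
          linarith
    have hR : (!![c, -s; s, c] : Mat 2) ∈ Matrix.specialOrthogonalGroup (Fin 2) ℝ := by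
      rw [Matrix.mem_specialOrthogonalGroup_iff, Matrix.mem_orthogonalGroup_iff]
      refine ⟨?_, by rw [Matrix.det_fin_two_of]; linarith⟩
      ext i j
      fin_cases i <;> fin_cases j <;>
        simp [Matrix.mul_apply, Fin.sum_univ_two] <;> linarith
    refine (ciInf_le ⟨0, ?_⟩ ⟨_, hR⟩).trans_eq ?_
    · rintro _ ⟨R, rfl⟩
      exact Finset.sum_nonneg fun i _ => Finset.sum_nonneg fun j _ => sq_nonneg _
    · rw [← h, frobSq_two, frobSq_two]
      simp
      linear_combination 2 * hcs
  · obtain ⟨R, hR⟩ := R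
    rw [Matrix.mem_specialOrthogonalGroup_iff, Matrix.mem_orthogonalGroup_iff] at hR
    obtain ⟨hR, hdet⟩ := hR
    have h0 := congrFun (congrFun hR 0) 0
    have h1 := congrFun (congrFun hR 1) 1
    simp [Matrix.mul_apply, Fin.sum_univ_two] at h0 h1
    rw [Matrix.det_fin_two] at hdet
    -- `(R₁₁ - R₀₀)² + (R₀₁ + R₁₀)² = ‖R‖² - 2 det R = 0`.
    have e0 : R 1 1 = R 0 0 := by nlinarith [sq_nonneg (R 1 1 - R 0 0), sq_nonneg (R 0 1 + R 1 0)]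
    have e1 : R 0 1 = -R 1 0 := by nlinarith [sq_nonneg (R 1 1 - R 0 0), sq_nonneg (R 0 1 + R 1 0)]
    have h := le_sqrt_sq_add_sq (c := R 0 0) (s := R 1 0) (by rw [e1] at h0; linarith)
      (X 0 0 + X 1 1) (X 1 0 - X 0 1)
    rw [conf, frobSq_two, frobSq_two]
    simp only [Matrix.sub_apply, e0, e1]
    rw [e1] at h0
    linarith

/-- With `S = √(XᵀX)`, `tr S² = ‖X‖²` and `det S = |det X|`, hence `(tr S)² = ‖X‖² + 2 |det X|` by
Cayley–Hamilton. -/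
lemma wBiot_eq (X : Mat 2) : wBiot X = frobSq X + 2 - 2 * √(frobSq X + 2 * |X.det|) := by
  have hM : 0 ≤ X.transpose * X := by
    rw [Matrix.nonneg_iff_posSemidef]
    simpa using Matrix.posSemidef_conjTranspose_mul_self X
  have hS : (CFC.sqrt (X.transpose * X)).PosSemidef :=
    Matrix.nonneg_iff_posSemidef.1 (CFC.sqrt_nonneg _)
  have hSS : CFC.sqrt (X.transpose * X) * CFC.sqrt (X.transpose * X) = X.transpose * X :=
    CFC.sqrt_mul_sqrt_self _ hM
  rw [wBiot]
  generalize CFC.sqrt (X.transpose * X) = S at *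
  have hsym : S 1 0 = S 0 1 := by simpa using hS.isHermitian.apply 0 1
  have htr : 0 ≤ S 0 0 + S 1 1 := by simpa [Matrix.trace_fin_two] using hS.trace_nonneg
  have hdet : S.det = |X.det| := by
    have h := congrArg Matrix.det hSS
    rw [Matrix.det_mul, Matrix.det_mul, Matrix.det_transpose] at h
    rw [← abs_of_nonneg hS.det_nonneg]
    exact abs_eq_abs.2 (mul_self_eq_mul_self_iff.1 h)
  have h0 := congrFun (congrFun hSS 0) 0
  have h1 := congrFun (congrFun hSS 1) 1
  simp only [Matrix.mul_apply, Fin.sum_univ_two, Matrix.transpose_apply, hsym] at h0 h1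
  have hsq : frobSq X + 2 * |X.det| = (S 0 0 + S 1 1) ^ 2 := by
    rw [← hdet, Matrix.det_fin_two, hsym, frobSq_two]
    linarith
  rw [hsq, Real.sqrt_sq htr, frobSq_two, frobSq_two]
  simp [hsym]
  linarith

lemma wBiot_eq_wDist {F : Mat 2} (hF : 0 < F.det) : wBiot F = wDist F := by
  rw [wBiot_eq, wDist_eq, abs_of_pos hF, conf_eq_sqrt]

lemma continuous_wDist : Continuous fun X : Mat 2 => wDist X := by
  simp only [wDist_eq]
  exact (continuous_frobSq.add continuous_const).sub (continuous_const.mul continuous_conf)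

lemma continuous_wBiot : Continuous fun X : Mat 2 => wBiot X := by
  simp only [wBiot_eq]
  exact (continuous_frobSq.add continuous_const).sub (continuous_const.mul
    (continuous_frobSq.add (continuous_const.mul continuous_id.matrix_det.abs)).sqrt)

/-! ### Polyconvex lower bounds -/

lemma exists_subgradient_norm (u v : ℝ) : ∃ e f : ℝ, ∀ x y : ℝ,
    √(u ^ 2 + v ^ 2) + (e * x + f * y) ≤ √((u + x) ^ 2 + (v + y) ^ 2) := by
  rcases (Real.sqrt_nonneg (u ^ 2 + v ^ 2)).eq_or_lt with h | h
  · refine ⟨0, 0, fun x y => ?_⟩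
    rw [← h]
    simp
  · have hsq : √(u ^ 2 + v ^ 2) ^ 2 = u ^ 2 + v ^ 2 := Real.sq_sqrt (by positivity)
    set r := √(u ^ 2 + v ^ 2)
    refine ⟨u / r, v / r, fun x y => ?_⟩
    have h1 : (u / r) ^ 2 + (v / r) ^ 2 = 1 := by
      rw [div_pow, div_pow, ← add_div, ← hsq, div_self (by positivity)]
    refine le_trans (le_of_eq ?_) (le_sqrt_sq_add_sq h1 (u + x) (v + y))
    field_simp
    linarith

/-- The map `s ↦ ((s - 1)₊)²` is convex and nondecreasing, so it carries an affine lower bound of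
its argument to one of its value. -/
lemma posPart_sq_subgradient {x y l : ℝ} (h : x + l ≤ y) :
    max (x - 1) 0 ^ 2 + 2 * max (x - 1) 0 * l ≤ max (y - 1) 0 ^ 2 := by
  rcases le_total (x - 1) 0 with hx | hx
  · rw [max_eq_right hx]
    simp
  · rw [max_eq_left hx]
    have hy := le_max_left (y - 1) 0
    nlinarith [sq_nonneg (max (y - 1) 0 - (x - 1)), mul_nonneg hx (sub_nonneg.2 h),
      mul_nonneg hx (sub_nonneg.2 hy)]

/-- The relaxation of `wDist`. -/
noncomputable def relaxedDist (X : Mat 2) : ℝ := max (conf X - 1) 0 ^ 2 + (1 - 2 * X.det)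

/-- A convex function below `wBiot`, given by the largest singular value `(conf + anticonf) / 2`. -/
noncomputable def relaxedBiot (X : Mat 2) : ℝ := max ((conf X + anticonf X) / 2 - 1) 0 ^ 2

lemma hasPolyaffineMinorants_relaxedDist : HasPolyaffineMinorants relaxedDist := by
  intro F
  obtain ⟨e, f, h⟩ := exists_subgradient_norm (F 0 0 + F 1 1) (F 1 0 - F 0 1)
  set M := max (conf F - 1) 0 with hM
  -- The linear part is `2 * M` times a subgradient of `conf`, minus `2 cof F`, which together with
  -- `-2 det X` accounts for `-2 det (F + X)`.
  refine ⟨![![2 * M * e - 2 * F 1 1, -(2 * M * f) + 2 * F 1 0],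
    ![2 * M * f + 2 * F 0 1, 2 * M * e - 2 * F 0 0]], -2, fun X => ?_⟩
  have h1 : conf F + (e * (X 0 0 + X 1 1) + f * (X 1 0 - X 0 1)) ≤ conf (F + X) := by
    refine (h _ _).trans_eq ?_
    simp only [conf, Matrix.add_apply]
    ring_nf
  have h2 := posPart_sq_subgradient h1
  rw [← hM] at h2
  rw [relaxedDist, relaxedDist, ← hM]
  simp only [Fin.sum_univ_two, Matrix.det_fin_two, Matrix.add_apply, Matrix.cons_val_zero,
    Matrix.cons_val_one]
  linarith

lemma hasPolyaffineMinorants_relaxedBiot : HasPolyaffineMinorants relaxedBiot := by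
  intro F
  obtain ⟨e, f, h⟩ := exists_subgradient_norm (F 0 0 + F 1 1) (F 1 0 - F 0 1)
  obtain ⟨e', f', h'⟩ := exists_subgradient_norm (F 0 0 - F 1 1) (F 1 0 + F 0 1)
  set M := max ((conf F + anticonf F) / 2 - 1) 0 with hM
  refine ⟨![![M * (e + e'), M * (-f + f')], ![M * (f + f'), M * (e - e')]], 0, fun X => ?_⟩
  have h1 : conf F + (e * (X 0 0 + X 1 1) + f * (X 1 0 - X 0 1)) ≤ conf (F + X) := by
    refine (h _ _).trans_eq ?_
    simp only [conf, Matrix.add_apply]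
    ring_nf
  have h1' : anticonf F + (e' * (X 0 0 - X 1 1) + f' * (X 1 0 + X 0 1)) ≤ anticonf (F + X) := by
    refine (h' _ _).trans_eq ?_
    simp only [anticonf, Matrix.add_apply]
    ring_nf
  have h2 := posPart_sq_subgradient (x := (conf F + anticonf F) / 2)
    (y := (conf (F + X) + anticonf (F + X)) / 2)
    (l := ((e * (X 0 0 + X 1 1) + f * (X 1 0 - X 0 1)) +
      (e' * (X 0 0 - X 1 1) + f' * (X 1 0 + X 0 1))) / 2) (by linarith)
  rw [← hM] at h2
  rw [relaxedBiot, relaxedBiot, ← hM]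
  simp only [Fin.sum_univ_two, Matrix.cons_val_zero, Matrix.cons_val_one]
  linarith

lemma wDist_eq_of_one_le_conf {X : Mat 2} (h : 1 ≤ conf X) : wDist X = relaxedDist X := by
  rw [wDist_eq, relaxedDist, max_eq_left (by linarith)]
  linarith [conf_sq X]

lemma relaxedDist_le_wDist (X : Mat 2) : relaxedDist X ≤ wDist X := by
  rcases le_total 1 (conf X) with h | h
  · exact (wDist_eq_of_one_le_conf h).ge
  · rw [wDist_eq, relaxedDist, max_eq_right (by linarith)]
    nlinarith [conf_sq X, sq_nonneg (conf X - 1)]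

/-- In singular values `wBiot` is `(σ₁ - 1)² + (σ₂ - 1)²`; the square belonging to the smaller one
is dropped. For negative determinant `conf` and `anticonf` exchange roles. -/
lemma relaxedBiot_le_wBiot (X : Mat 2) : relaxedBiot X ≤ wBiot X := by
  have hc := conf_nonneg X
  have ha := anticonf_nonneg X
  have hc2 := conf_sq X
  have ha2 := anticonf_sq X
  have hpos : max ((conf X + anticonf X) / 2 - 1) 0 ^ 2 ≤ ((conf X + anticonf X) / 2 - 1) ^ 2 := by
    rcases le_total ((conf X + anticonf X) / 2 - 1) 0 with h | h
    · rw [max_eq_right h]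
      simpa using sq_nonneg _
    · rw [max_eq_left h]
  refine hpos.trans ?_
  rw [wBiot_eq]
  rcases le_total 0 X.det with h | h
  · rw [abs_of_nonneg h, ← conf_eq_sqrt]
    nlinarith [sq_nonneg (conf X - 2 - anticonf X)]
  · rw [abs_of_nonpos h, show frobSq X + 2 * -X.det = frobSq X - 2 * X.det by ring,
      ← anticonf_eq_sqrt]
    nlinarith [sq_nonneg (anticonf X - 2 - conf X)]

/-! ### Envelopes -/

lemma qcEnvelope_eq {W Z : Mat 2 → ℝ} (hZ : HasPolyaffineMinorants Z) (hle : ∀ X, Z X ≤ W X)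
    {F : Mat 2}
    (hF : ∀ w : Mat 2 → EReal, Quasiconvex w → (∀ X, w X ≤ (W X : EReal)) → w F ≤ Z F) :
    qcEnvelope W F = Z F := by
  refine le_antisymm (sSup_le ?_) (le_sSup ⟨_, hZ.quasiconvex, fun X => mod_cast hle X, rfl⟩)
  rintro _ ⟨w, hw, hwW, rfl⟩
  exact hF w hw hwW

/-- The upper bound is asked of functions on all matrices, so that it applies to the extension by
`+∞` and one lamination argument can serve both envelopes. -/
lemma qcEnvelopeGL_eq {W Z : Mat 2 → ℝ} (hZ : HasPolyaffineMinorants Z) (hle : ∀ X, Z X ≤ W X)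
    {F : GLPlus 2} (hF : ∀ w : Mat 2 → EReal, Quasiconvex w →
      (∀ X : Mat 2, 0 < X.det → w X ≤ (W X : EReal)) → w F.1 ≤ Z F.1) :
    qcEnvelopeGL (restrictGL W) F = Z F.1 := by
  refine le_antisymm (sSup_le ?_) (le_sSup ⟨_, hZ.quasiconvexGL, fun X => hle X.1, rfl⟩)
  rintro _ ⟨w, hw, hwW, rfl⟩
  have := hF _ hw fun X hX => by
    rw [extendTop, dif_pos hX]
    exact mod_cast hwW ⟨X, hX⟩
  rwa [extendTop, dif_pos F.2] at this

lemma eventually_le_of_continuous {w : Mat 2 → EReal} {W : Mat 2 → ℝ} (hW : Continuous W)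
    {X : Mat 2} (hle : ∀ᶠ Y in 𝓝 X, w Y ≤ W Y) {r : ℝ} (hr : W X < r) :
    ∀ᶠ Y in 𝓝 X, w Y ≤ r := by
  filter_upwards [hle, hW.continuousAt.eventually_lt continuousAt_const hr] with Y h1 h2
  exact h1.trans (mod_cast h2.le)

lemma exists_roots_of_neg {a b c : ℝ} (ha : 0 < a) (hc : c < 0) :
    ∃ t₁ < 0, ∃ t₂ > 0, a * t₁ ^ 2 + 2 * b * t₁ + c = 0 ∧ a * t₂ ^ 2 + 2 * b * t₂ + c = 0 := by
  have hac : 0 < a * -c := mul_pos ha (neg_pos.2 hc)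
  have hsq : √(b ^ 2 + a * -c) ^ 2 = b ^ 2 + a * -c := Real.sq_sqrt (by positivity)
  have hlt : |b| < √(b ^ 2 + a * -c) := by
    rw [← Real.sqrt_sq_eq_abs]
    exact Real.sqrt_lt_sqrt (sq_nonneg b) (by linarith)
  set d := √(b ^ 2 + a * -c)
  obtain ⟨h1, h2⟩ := abs_lt.1 hlt
  refine ⟨(-b - d) / a, div_neg_of_neg_of_pos (by linarith) ha, (-b + d) / a,
    div_pos (by linarith) ha, ?_, ?_⟩
  · field_simp
    linarith
  · field_simp
    linarith

/-- The relaxation of `wDist` bounds every quasiconvex function below `wDist` on `GL⁺(2)`. -/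
lemma Quasiconvex.le_relaxedDist {w : Mat 2 → EReal} (hw : Quasiconvex w)
    (hle : ∀ X : Mat 2, 0 < X.det → w X ≤ (wDist X : EReal)) {F : Mat 2} (hF : 0 < F.det) :
    w F ≤ relaxedDist F := by
  rcases le_or_gt 1 (conf F) with h1 | h1
  · exact wDist_eq_of_one_le_conf h1 ▸ hle F hF
  have hval : relaxedDist F = 1 - 2 * F.det := by
    rw [relaxedDist, max_eq_right (by linarith)]
    ring
  have hC : frobSq F + 2 * F.det - 1 < 0 := by
    rw [← conf_sq]
    nlinarith [conf_nonneg F]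
  have hA : 0 < F 0 0 ^ 2 + F 1 0 ^ 2 := by
    rw [Matrix.det_fin_two] at hF
    by_contra h
    have h0 : F 0 0 = 0 := by nlinarith [sq_nonneg (F 0 0), sq_nonneg (F 1 0)]
    have h1 : F 1 0 = 0 := by nlinarith [sq_nonneg (F 0 0), sq_nonneg (F 1 0)]
    simp [h0, h1] at hF
  -- The quadratic is `conf² - 1` along `F + t f₁ ⊗ e₂`, with `f₁` the first column of `F`. It is
  -- negative at `t = 0`, so its roots lie on both sides.
  obtain ⟨t₁, ht₁, t₂, ht₂, e₁, e₂⟩ :=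
    exists_roots_of_neg (b := F 0 0 * F 0 1 + F 1 0 * F 1 1) hA hC
  have key : ∀ t : ℝ, (F 0 0 ^ 2 + F 1 0 ^ 2) * t ^ 2 +
      2 * (F 0 0 * F 0 1 + F 1 0 * F 1 1) * t + (frobSq F + 2 * F.det - 1) = 0 →
      ∀ r : ℝ, 1 - 2 * F.det < r →
        ∀ᶠ X in 𝓝 (F + t • Matrix.vecMulVec ![F 0 0, F 1 0] ![0, 1]), w X ≤ r := by
    intro t ht r hr
    have hdet : (F + t • Matrix.vecMulVec ![F 0 0, F 1 0] ![0, 1]).det = F.det := by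
      simp [Matrix.det_fin_two]
      ring
    have hfrob : frobSq (F + t • Matrix.vecMulVec ![F 0 0, F 1 0] ![0, 1]) + 2 * F.det = 1 := by
      rw [frobSq_two] at ht ⊢
      simp
      linarith
    refine eventually_le_of_continuous continuous_wDist ?_ ?_
    · have : ∀ᶠ X : Mat 2 in 𝓝 (F + t • Matrix.vecMulVec ![F 0 0, F 1 0] ![0, 1]), 0 < X.det :=
        continuousAt_const.eventually_lt continuous_id.matrix_det.continuousAt
          (by simpa only [id, hdet] using hF)
      exact this.mono hle
    · rw [wDist_eq, conf_eq_sqrt, hdet, hfrob, Real.sqrt_one]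
      linarith
  rw [hval]
  exact hw.le_of_lamination (by simp) ht₁ ht₂ (key t₁ e₁) (key t₂ e₂)

lemma qcEnvelopeGL_wDist (F : GLPlus 2) :
    qcEnvelopeGL (restrictGL wDist) F = relaxedDist F.1 :=
  qcEnvelopeGL_eq hasPolyaffineMinorants_relaxedDist relaxedDist_le_wDist
    fun _ hw hle => hw.le_relaxedDist hle F.2

lemma qcEnvelope_wDist (F : GLPlus 2) : qcEnvelope wDist F.1 = relaxedDist F.1 :=
  qcEnvelope_eq hasPolyaffineMinorants_relaxedDist relaxedDist_le_wDist
    fun _ hw hle => hw.le_relaxedDist (fun X _ => hle X) F.2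

lemma restrictGL_wBiot : restrictGL (wBiot (n := 2)) = restrictGL wDist :=
  funext fun F => wBiot_eq_wDist F.2

lemma relaxedDist_eq_ite (F : Mat 2) :
    relaxedDist F = if frobSq F + 2 * F.det < 1 then 1 - 2 * F.det
      else (√(frobSq F + 2 * F.det) - 1) ^ 2 + 1 - 2 * F.det := by
  rw [relaxedDist, ← conf_eq_sqrt, ← conf_sq]
  have hc := conf_nonneg F
  split_ifs with h
  · rw [max_eq_right (by nlinarith)]
    ring
  · rw [max_eq_left (by nlinarith)]
    ring

/-! ### Simple shear -/

lemma shear_entries (γ : ℝ) : (shear γ).1 0 0 = 1 ∧ (shear γ).1 0 1 = γ ∧ (shear γ).1 1 0 = 0 ∧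
    (shear γ).1 1 1 = 1 := by
  simp [shear]

lemma det_shear (γ : ℝ) : (shear γ).1.det = 1 := by
  simp [shear, Matrix.det_fin_two]

lemma frobSq_shear (γ : ℝ) : frobSq (shear γ).1 = 2 + γ ^ 2 := by
  obtain ⟨h1, h2, h3, h4⟩ := shear_entries γ
  rw [frobSq_two, h1, h2, h3, h4]
  ring

lemma conf_shear (γ : ℝ) : conf (shear γ).1 = √(4 + γ ^ 2) := by
  rw [conf_eq_sqrt, det_shear, frobSq_shear]
  ring_nf

lemma anticonf_shear (γ : ℝ) : anticonf (shear γ).1 = |γ| := by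
  rw [anticonf_eq_sqrt, det_shear, frobSq_shear, ← Real.sqrt_sq_eq_abs]
  ring_nf

lemma two_le_sqrt_four_add_sq (γ : ℝ) : 2 ≤ √(4 + γ ^ 2) :=
  Real.le_sqrt_of_sq_le (by nlinarith [sq_nonneg γ])

lemma relaxedDist_shear (γ : ℝ) : relaxedDist (shear γ).1 = (√(4 + γ ^ 2) - 1) ^ 2 - 1 := by
  rw [relaxedDist, conf_shear, det_shear,
    max_eq_left (by linarith [two_le_sqrt_four_add_sq γ])]
  ring

lemma wBiot_shear (γ : ℝ) : wBiot (shear γ).1 = (√(4 + γ ^ 2) - 1) ^ 2 - 1 := by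
  rw [wBiot_eq_wDist (shear γ).2, ← relaxedDist_shear]
  exact wDist_eq_of_one_le_conf (by linarith [conf_shear γ, two_le_sqrt_four_add_sq γ])

lemma relaxedBiot_shear (γ : ℝ) :
    relaxedBiot (shear γ).1 = ((√(γ ^ 2 + 4) + |γ|) / 2 - 1) ^ 2 := by
  have h := two_le_sqrt_four_add_sq γ
  rw [relaxedBiot, conf_shear, anticonf_shear, max_eq_left (by linarith [abs_nonneg γ]),
    add_comm (γ ^ 2)]

/-- On simple shears, every quasiconvex function below `wBiot` lies below `relaxedBiot`. -/
lemma Quasiconvex.le_relaxedBiot_shear {w : Mat 2 → EReal} (hw : Quasiconvex w)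
    (hle : ∀ X : Mat 2, w X ≤ (wBiot X : EReal)) (γ : ℝ) :
    w (shear γ).1 ≤ relaxedBiot (shear γ).1 := by
  -- At `γ = 0` the smaller singular value is already `1` and the segment below degenerates; there
  -- `wBiot` vanishes.
  rcases eq_or_ne γ 0 with rfl | hγ
  · refine (hle _).trans (le_of_eq ?_)
    rw [wBiot_shear, relaxedBiot_shear]
    have : √(4 : ℝ) = 2 := by
      rw [show (4 : ℝ) = 2 ^ 2 by norm_num, Real.sqrt_sq zero_le_two]
    norm_num [this]
  obtain ⟨s, hs, hsγ⟩ : ∃ s : ℝ, s ^ 2 = 1 ∧ γ = s * |γ| := by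
    rcases abs_cases γ with ⟨h, -⟩ | ⟨h, -⟩
    · exact ⟨1, by norm_num, by rw [h, one_mul]⟩
    · exact ⟨-1, by norm_num, by rw [h]; ring⟩
  have hγ' : 0 < |γ| := abs_pos.2 hγ
  have hroot : √(γ ^ 2 + 4) ^ 2 = |γ| ^ 2 + 4 := by
    rw [Real.sq_sqrt (by positivity), sq_abs]
  rw [relaxedBiot_shear]
  have hroot0 := Real.sqrt_nonneg (γ ^ 2 + 4)
  obtain ⟨σ, hσ⟩ : ∃ σ, σ = (√(γ ^ 2 + 4) + |γ|) / 2 := ⟨_, rfl⟩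
  obtain ⟨ρ, hρ⟩ : ∃ ρ, ρ = (√(γ ^ 2 + 4) - |γ|) / 2 := ⟨_, rfl⟩
  have hσρ : σ * ρ = 1 := by
    rw [hσ, hρ]
    linarith
  have habs : |γ| = σ - ρ := by
    rw [hσ, hρ]
    ring
  have hσ0 : 0 < σ := by
    rw [hσ]
    positivity
  have hρ0 : 0 < ρ := by
    by_contra h
    nlinarith
  have hρ1 : ρ < 1 := by
    rw [habs] at hγ'
    nlinarith
  rw [← hσ]
  rw [habs] at hsγ
  obtain ⟨f1, f2, f3, f4⟩ := shear_entries γ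
  -- The shear has singular values `σ` and `ρ = 1 / σ`, and `![σ, -s]`, `![1, -(s * σ)]` are right
  -- and left singular vectors for `ρ`, each of squared length `1 + σ²`. The chosen `t` replaces `ρ`
  -- by `ε = ±1`, leaving the energy `(σ - 1)²`.
  have key : ∀ ε : ℝ, ε ^ 2 = 1 → ∀ r : ℝ, (σ - 1) ^ 2 < r →
      ∀ᶠ X in 𝓝 ((shear γ).1 + ((ε - ρ) / (1 + σ ^ 2)) •
        Matrix.vecMulVec ![1, -(s * σ)] ![σ, -s]), w X ≤ r := by
    intro ε hε r hr
    refine eventually_le_of_continuous continuous_wBiot (Eventually.of_forall hle) ?_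
    refine lt_of_eq_of_lt ?_ hr
    have hT : (ε - ρ) / (1 + σ ^ 2) * (1 + σ ^ 2) = ε - ρ := div_mul_cancel₀ _ (by positivity)
    generalize (ε - ρ) / (1 + σ ^ 2) = t at hT ⊢
    have hdet : ((shear γ).1 + t • Matrix.vecMulVec ![1, -(s * σ)] ![σ, -s]).det = ε * σ := by
      rw [Matrix.det_fin_two]
      simp [f1, f2, f3, f4]
      rw [hsγ]
      linear_combination (t * σ ^ 2 * (σ - ρ - t) + (1 + t * σ) * (t * σ)) * hs + σ * hT - (1 + t * σ) * hσρ
    have hfrob : frobSq ((shear γ).1 + t • Matrix.vecMulVec ![1, -(s * σ)] ![σ, -s]) =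
        σ ^ 2 + 1 := by
      rw [frobSq_two]
      simp [f1, f2, f3, f4]
      rw [hsγ]
      linear_combination ((σ - ρ - t) ^ 2 + t ^ 2 * σ ^ 4 +
        t * σ * (2 + t * σ * (s ^ 2 + 1))) * hs - (2 + 2 * t * σ) * hσρ +
        (t * (1 + σ ^ 2) + ρ + ε) * hT + hε
    have habsdet : |ε * σ| = σ := by
      rw [sq, mul_self_eq_one_iff] at hε
      rcases hε with rfl | rfl <;> simp [abs_of_pos hσ0]
    rw [wBiot_eq, hdet, hfrob, habsdet, show σ ^ 2 + 1 + 2 * σ = (σ + 1) ^ 2 by ring,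
      Real.sqrt_sq (by positivity)]
    ring
  refine hw.le_of_lamination ?_ (div_neg_of_neg_of_pos ?_ ?_) (div_pos ?_ ?_)
    (key (-1) (by norm_num)) (key 1 (by norm_num))
  · intro h
    exact hσ0.ne' (congrFun h 0)
  all_goals first | positivity | linarith

lemma qcEnvelope_wBiot_shear (γ : ℝ) :
    qcEnvelope wBiot (shear γ).1 = (((√(γ ^ 2 + 4) + |γ|) / 2 - 1) ^ 2 : ℝ) := by
  rw [← relaxedBiot_shear]
  exact qcEnvelope_eq hasPolyaffineMinorants_relaxedBiot relaxedBiot_le_wBiot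
    fun _ hw hle => hw.le_relaxedBiot_shear hle γ

/-- The difference is `(1 - ρ)²`, with `ρ = (√(4 + γ²) - |γ|) / 2 < 1` the smaller singular value.
-/
lemma relaxedBiot_shear_lt_relaxedDist_shear {γ : ℝ} (hγ : γ ≠ 0) :
    ((√(γ ^ 2 + 4) + |γ|) / 2 - 1) ^ 2 < (√(4 + γ ^ 2) - 1) ^ 2 - 1 := by
  have h0 : 0 < |γ| := abs_pos.2 hγ
  rw [add_comm (γ ^ 2)]
  have h2 := two_le_sqrt_four_add_sq γ
  have hsq : √(4 + γ ^ 2) ^ 2 = 4 + |γ| ^ 2 := by rw [Real.sq_sqrt (by positivity), sq_abs]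
  set S := √(4 + γ ^ 2)
  have hρ : (S - |γ|) / 2 < 1 := by nlinarith
  nlinarith [mul_pos (sub_pos.2 hρ) (sub_pos.2 hρ)]

end BiotRelaxation

theorem mainTheorem4 :
    (∀ F : BiotRelaxation.GLPlus 2,
      BiotRelaxation.wBiot F.1 = BiotRelaxation.wDist F.1 ∧
      BiotRelaxation.qcEnvelopeGL (BiotRelaxation.restrictGL BiotRelaxation.wBiot) F =
        BiotRelaxation.qcEnvelopeGL (BiotRelaxation.restrictGL BiotRelaxation.wDist) F ∧
      BiotRelaxation.qcEnvelopeGL (BiotRelaxation.restrictGL BiotRelaxation.wDist) F =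
        BiotRelaxation.qcEnvelope BiotRelaxation.wDist F.1 ∧
      BiotRelaxation.qcEnvelope BiotRelaxation.wDist F.1 =
        ((if BiotRelaxation.frobSq F.1 + 2 * F.1.det < 1 then 1 - 2 * F.1.det
          else (Real.sqrt (BiotRelaxation.frobSq F.1 + 2 * F.1.det) - 1) ^ 2
            + 1 - 2 * F.1.det : ℝ) : EReal)) ∧
    (∀ γ : ℝ,
      BiotRelaxation.qcEnvelopeGL (BiotRelaxation.restrictGL BiotRelaxation.wBiot)
          (BiotRelaxation.shear γ) =
        (((Real.sqrt (4 + γ ^ 2) - 1) ^ 2 - 1 : ℝ) : EReal) ∧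
      BiotRelaxation.wBiot (BiotRelaxation.shear γ).1 = (Real.sqrt (4 + γ ^ 2) - 1) ^ 2 - 1 ∧
      BiotRelaxation.qcEnvelope BiotRelaxation.wBiot (BiotRelaxation.shear γ).1 =
        ((((Real.sqrt (γ ^ 2 + 4) + |γ|) / 2 - 1) ^ 2 : ℝ) : EReal) ∧
      (γ ≠ 0 →
        BiotRelaxation.qcEnvelope BiotRelaxation.wBiot (BiotRelaxation.shear γ).1 <
          BiotRelaxation.qcEnvelopeGL (BiotRelaxation.restrictGL BiotRelaxation.wBiot)
            (BiotRelaxation.shear γ))) := by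
  refine ⟨fun F => ⟨BiotRelaxation.wBiot_eq_wDist F.2, by rw [BiotRelaxation.restrictGL_wBiot],
    by rw [BiotRelaxation.qcEnvelopeGL_wDist, BiotRelaxation.qcEnvelope_wDist],
    by rw [BiotRelaxation.qcEnvelope_wDist, BiotRelaxation.relaxedDist_eq_ite]⟩, fun γ => ?_⟩
  have h : BiotRelaxation.qcEnvelopeGL (BiotRelaxation.restrictGL BiotRelaxation.wBiot)
      (BiotRelaxation.shear γ) = (((Real.sqrt (4 + γ ^ 2) - 1) ^ 2 - 1 : ℝ) : EReal) := by
    rw [BiotRelaxation.restrictGL_wBiot, BiotRelaxation.qcEnvelopeGL_wDist,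
      BiotRelaxation.relaxedDist_shear]
  refine ⟨h, BiotRelaxation.wBiot_shear γ, BiotRelaxation.qcEnvelope_wBiot_shear γ, fun hγ => ?_⟩
  rw [h, BiotRelaxation.qcEnvelope_wBiot_shear, EReal.coe_lt_coe_iff]
  exact BiotRelaxation.relaxedBiot_shear_lt_relaxedDist_shear hγ
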